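/- Fix a noise variance $\sigma^2>0$. A real filter $\Psi=(\psi_1,\dots,\psi_{L_0})\in\mathbb{R}^{L_0}$ all of whose roots, i.e. the roots of $z^{L_0}+\sum_{\ell=1}^{L_0}\psi_\ell z^{L_0-\ell}$, have modulus less than $1$ determines the stationary autoregressive process $x_n+\psi_1x_{n-1}+\cdots+\psi_{L_0}x_{n-L_0}=\varepsilon_n$ $(n\in\mathbb{Z})$, where the $\varepsilon_n$ are i.i.d. $\mathcal N(0,\sigma^2)$. For $L\ge 1$ let $(\psi_{L,1},\dots,\psi_{L,L})$ be the best linear predictor of order $L$ of this process, that is, the minimizer over $c\in\mathbb{R}^L$ of $E\{(x_n+c_1x_{n-1}+\cdots+c_Lx_{n-L})^2\}$, and let $e_L$ be the minimum, with $e_0=E\{x_n^2\}$. The number $\psi_{L,L}$ is the partial autocorrelation of order $L$, and $g_L=\log(e_{L-1}/e_L)$. Let $S_{L_0}(1)\subset\mathbb{R}^{L_0}$ be the set of real filters of order $L_0$ all of whose roots have modulus at most $1$; the filters in it with a root of modulus exactly $1$ form a Lebesgue null set. (i) Let $L_0\ge 1$ and let the filter $\Psi_{L_0}$ be random and uniformly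 distributed (with respect to Lebesgue measure on $\mathbb{R}^{L_0}$) on $S_{L_0}(1)$. Then the partial autocorrelations $\psi_{1,1},\dots,\psi_{L_0,L_0}$ are independent, and for $L=1,\dots,L_0$ $$\frac{\psi_{L,L}+1}{2}\sim \mathrm{Beta}\bigl(\lfloor L/2+1\rfloor,\ \lfloor (L+1)/2\rfloor\bigr).$$ (ii) For each $L$ let the filter be uniformly distributed on $S_{L_0}(1)$ with an order $L_0=L_0(L)\ge L$, chosen arbitrarily. Then $L\,\psi_{L,L}^2$ and $L\,g_L$ each converge in distribution to $\chi^2_1$ as $L\to\infty$. -/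

import Mathlib

open MeasureTheory ProbabilityTheory Filter
open scoped NNReal ENNReal Topology

noncomputable section

namespace ARFilter

/-- A real autoregressive filter of order `L` is a vector `(ψ₁, …, ψ_L)`; the coefficient `ψ_ℓ`
is stored at the index `ℓ - 1`.  Its polynomial is `z ^ L + ∑ ψ_ℓ z ^ (L - ℓ)`. -/
def filterPoly {L : ℕ} (a : Fin L → ℝ) : Polynomial ℝ :=
  Polynomial.X ^ L +
    ∑ i : Fin L, Polynomial.C (a i) * Polynomial.X ^ (L - ((i : ℕ) + 1))

/-- The set `S_L(r)` of real filters of order `L` all of whose roots have modulus at most `r`. -/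
def stableSet (L : ℕ) (r : ℝ) : Set (Fin L → ℝ) :=
  {a | ∃ z : Fin L → ℂ, (∀ i, ‖z i‖ ≤ r) ∧
    (filterPoly a).map (algebraMap ℝ ℂ) =
      ∏ i : Fin L, (Polynomial.X - Polynomial.C (z i))}

/-- `X` is a (wide-sense) stationary autoregressive process with filter `a`, driven by the
noise `ε`, whose terms are independent centred Gaussian with variance `v`:
`X n + ψ₁ X (n - 1) + ⋯ + ψ_L X (n - L) = ε n` almost surely, for every integer time `n`. -/
structure IsStationaryAR {Ω : Type*} [MeasurableSpace Ω] (P : Measure Ω) (v : ℝ≥0) {L : ℕ}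
    (a : Fin L → ℝ) (ε X : ℤ → Ω → ℝ) : Prop where
  noise_law : ∀ n, HasLaw (ε n) (gaussianReal 0 v) P
  noise_indep : iIndepFun ε P
  memLp : ∀ n, MemLp (X n) 2 P
  mean_stationary : ∀ n, ∫ ω, X n ω ∂P = ∫ ω, X 0 ω ∂P
  cov_stationary : ∀ n k, ∫ ω, X (n + k) ω * X n ω ∂P = ∫ ω, X k ω * X 0 ω ∂P
  recursion : ∀ n, ∀ᵐ ω ∂P,
    X n ω + ∑ i : Fin L, a i * X (n - (((i : ℕ) : ℤ) + 1)) ω = ε n ω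

/-- The mean squared error `E (x_n + c₁ x_{n-1} + ⋯ + c_L x_{n-L})²` of a linear one-step
predictor of order `L`.  For a stationary process it does not depend on `n`; we take `n = 0`. -/
def predMSE {Ω : Type*} [MeasurableSpace Ω] (P : Measure Ω) (X : ℤ → Ω → ℝ) {L : ℕ}
    (c : Fin L → ℝ) : ℝ :=
  ∫ ω, (X 0 ω + ∑ i : Fin L, c i * X (0 - (((i : ℕ) : ℤ) + 1)) ω) ^ 2 ∂P

/-- The prediction error `e_L`: the minimum of the mean squared error over all linear predictors
of order `L`.  In particular `e_0 = E x_n² = γ_0`. -/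
def predErr {Ω : Type*} [MeasurableSpace Ω] (P : Measure Ω) (X : ℤ → Ω → ℝ) (L : ℕ) : ℝ :=
  ⨅ c : Fin L → ℝ, predMSE P X c

/-- The best linear predictor `Ψ_L = (ψ_{L,1}, …, ψ_{L,L})` of order `L`: the minimizer of the
mean squared error (unique for a process with nonsingular autocovariance matrices). -/
def bestPredictor {Ω : Type*} [MeasurableSpace Ω] (P : Measure Ω) (X : ℤ → Ω → ℝ) (L : ℕ) :
    Fin L → ℝ :=
  Classical.epsilon fun c : Fin L → ℝ => ∀ c' : Fin L → ℝ, predMSE P X c ≤ predMSE P X c'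

/-- The partial autocorrelation `ψ_{L,L}` for `L ≥ 1`: the last coefficient of the best linear
predictor of order `L`.  (The value at `L = 0` is a convention without significance.) -/
def pacf {Ω : Type*} [MeasurableSpace Ω] (P : Measure Ω) (X : ℤ → Ω → ℝ) : ℕ → ℝ
  | 0 => 0
  | m + 1 => bestPredictor P X (m + 1) (Fin.last m)

/-- The gain of goodness of fit `g_L = log (e_{L-1} / e_L)`, for `L ≥ 1`. -/
def gain {Ω : Type*} [MeasurableSpace Ω] (P : Measure Ω) (X : ℤ → Ω → ℝ) (L : ℕ) : ℝ :=
  Real.log (predErr P X (L - 1) / predErr P X L)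

/-- The law of Gaussian white noise with variance `v`, on the space of two-sided sequences. -/
def whiteNoise (v : ℝ≥0) : Measure (ℤ → ℝ) :=
  Measure.infinitePi fun _ : ℤ => gaussianReal 0 v

/-- The stationary autoregressive process with filter `a` and noise variance `v`, realized on the
canonical space of the noise (whose terms are the coordinates).  If all roots of the filter have
modulus less than one, such a process exists and is unique up to almost sure equality.  (Filters
with a root on the unit circle, a Lebesgue null set, get an arbitrary value.) -/
def arProcess (v : ℝ≥0) {L : ℕ} (a : Fin L → ℝ) : ℤ → (ℤ → ℝ) → ℝ :=
  Classical.epsilon fun X : ℤ → (ℤ → ℝ) → ℝ =>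
    IsStationaryAR (whiteNoise v) v a (fun n w => w n) X

/-- The partial autocorrelation `ψ_{L,L}` of the autoregressive process with filter `a`. -/
def filterPacf (v : ℝ≥0) {L₀ : ℕ} (a : Fin L₀ → ℝ) (L : ℕ) : ℝ :=
  pacf (whiteNoise v) (arProcess v a) L

/-- The gain `g_L` of the autoregressive process with filter `a`. -/
def filterGain (v : ℝ≥0) {L₀ : ℕ} (a : Fin L₀ → ℝ) (L : ℕ) : ℝ :=
  gain (whiteNoise v) (arProcess v a) L

/-- The chi-square distribution with `k` degrees of freedom: the law of the sum of the squares
of `k` independent standard normal variables. -/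
def chiSquared (k : ℕ) : Measure ℝ :=
  (Measure.pi fun _ : Fin k => gaussianReal 0 1).map fun z => ∑ i, z i ^ 2

instance (k : ℕ) : IsProbabilityMeasure (chiSquared k) :=
  Measure.isProbabilityMeasure_map
    (Measurable.aemeasurable (by fun_prop))

end ARFilter

end

/-!
The law of the partial autocorrelations comes from a change of variables. For a stable filter of
order `L + 1` with last coefficient `k`, the step-down recursion `stepDown` produces a filter of
order `L`, and the Schur–Cohn criterion `mem_strictStable_succ_iff` says that the stable filters of
order `L + 1` correspond exactly to the pairs of some `k ∈ (-1, 1)` and a stable filter of order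
`L`. For fixed `k` the inverse of this correspondence is the linear map `1 + k J`, with `J` the
reversal of coordinates, and `|det (1 + k J)|` is an explicit product of powers of `1 ± k`
(`abs_det_stepUpMatrix`). So Lebesgue measure on the stable filters becomes a product measure in
the reflection coefficients, the values of `k` met along the recursion (`map_reflCoeff`).
Roots on the unit circle have probability zero, since shrinking all roots by a factor `r < 1` is a
linear map into the stable filters whose determinant tends to `1` (`volume_stableSet_le`).

It remains to identify the reflection coefficients with the partial autocorrelations. The power
series of a stable filter has an absolutely summable inverse. Applied to the noise in `L²`, the
inverse gives the stationary process, and every stationary solution is of this form; in particular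
`ε_n` is orthogonal to the past of the process. So the filter itself solves the normal equations of
its order, and by stationarity the step-down recursion passes from solutions of the normal
equations of order `L + 1` to those of order `L`, with prediction errors related by
`e_{L+1} = (1 - k²) e_L` (`exists_isNormalSol`). The orthogonality to the noise also gives the
uniqueness of the best predictors, whence `filterPacf_and_filterGain`.

The density of `√L ψ_{L,L}` is, up to a constant, `(1 - x²/L) ^ ⌊(L-1)/2⌋` times at most one factor
`1 + x/√L`. It converges to `exp (-x²/2)` under a Gaussian bound uniform in `L`, so dominated
convergence in the numerator and the denominator of a normalized integral gives the chi-square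
limit, both for `L ψ²` and for `-L log (1 - ψ²)`, without evaluating any constant
(`tendsto_integral_reflLaw`).
-/

namespace ARFilter

/-! ### The step-down recursion and stability of filters -/

/-- The value at `z` of the filter polynomial `z ^ L + ∑ ψ_ℓ z ^ (L - ℓ)`. -/
noncomputable def charEval {L : ℕ} (a : Fin L → ℝ) (z : ℂ) : ℂ :=
  z ^ L + ∑ i : Fin L, (a i : ℂ) * z ^ (L - ((i : ℕ) + 1))

/-- The value at `z` of the reversed filter polynomial `1 + ∑ ψ_ℓ z ^ ℓ`. -/
noncomputable def revEval {L : ℕ} (a : Fin L → ℝ) (z : ℂ) : ℂ :=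
  1 + ∑ i : Fin L, (a i : ℂ) * z ^ ((i : ℕ) + 1)

/-- The filters of order `L` all of whose roots have modulus less than `1`. -/
def strictStable (L : ℕ) : Set (Fin L → ℝ) :=
  {a | ∀ z : ℂ, charEval a z = 0 → ‖z‖ < 1}

/-- The step-down recursion of Levinson and Durbin, which recovers from a best linear predictor of
order `L + 1` the one of order `L`. -/
noncomputable def stepDown {L : ℕ} (a : Fin (L + 1) → ℝ) : Fin L → ℝ := fun i =>
  (a i.castSucc - a (Fin.last L) * a i.rev.castSucc) / (1 - a (Fin.last L) ^ 2)

/-- The reflection coefficients of a filter: the last coefficients of the filters of orders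
`1, …, L` which iterating `stepDown` produces. -/
noncomputable def reflCoeff : {L : ℕ} → (Fin L → ℝ) → Fin L → ℝ
  | 0, a => a
  | L + 1, a => Fin.snoc (α := fun _ => ℝ) (reflCoeff (stepDown a)) (a (Fin.last L))

theorem eval_filterPoly {L : ℕ} (a : Fin L → ℝ) (z : ℂ) :
    ((filterPoly a).map (algebraMap ℝ ℂ)).eval z = charEval a z := by
  simp [filterPoly, charEval, Polynomial.eval_finsetSum, Polynomial.map_sum]

theorem filterPoly_monic {L : ℕ} (a : Fin L → ℝ) : (filterPoly a).Monic := by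
  apply Polynomial.monic_X_pow_add
  refine (Polynomial.degree_sum_le _ _).trans_lt ?_
  refine (Finset.sup_lt_iff (by exact WithBot.bot_lt_coe L)).2 fun i _ => ?_
  refine (Polynomial.degree_C_mul_X_pow_le _ _).trans_lt ?_
  have := i.2
  exact_mod_cast (by omega : L - ((i : ℕ) + 1) < L)

theorem natDegree_filterPoly {L : ℕ} (a : Fin L → ℝ) : (filterPoly a).natDegree = L := by
  apply Polynomial.natDegree_eq_of_degree_eq_some
  rw [filterPoly, Polynomial.degree_add_eq_left_of_degree_lt, Polynomial.degree_X_pow]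
  rw [Polynomial.degree_X_pow]
  refine (Polynomial.degree_sum_le _ _).trans_lt ?_
  refine (Finset.sup_lt_iff (by exact WithBot.bot_lt_coe L)).2 fun i _ => ?_
  refine (Polynomial.degree_C_mul_X_pow_le _ _).trans_lt ?_
  have := i.2
  exact_mod_cast (by omega : L - ((i : ℕ) + 1) < L)

theorem exists_roots {L : ℕ} (a : Fin L → ℝ) : ∃ z : Fin L → ℂ,
    (filterPoly a).map (algebraMap ℝ ℂ) = ∏ i : Fin L, (Polynomial.X - Polynomial.C (z i)) := by
  have hs : ((filterPoly a).map (algebraMap ℝ ℂ)).Splits := IsAlgClosed.splits _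
  have hc : ((filterPoly a).map (algebraMap ℝ ℂ)).roots.toList.length = L := by
    rw [Multiset.length_toList, ← hs.natDegree_eq_card_roots,
      (filterPoly_monic a).natDegree_map, natDegree_filterPoly]
  have hp := hs.eq_prod_roots_of_monic ((filterPoly_monic a).map _)
  generalize (filterPoly a).map (algebraMap ℝ ℂ) = p at *
  subst hc
  refine ⟨p.roots.toList.get, hp.trans ?_⟩
  conv_lhs => rw [← Multiset.coe_toList p.roots]
  rw [Multiset.map_coe, Multiset.prod_coe, ← List.prod_ofFn]
  congr 1
  conv_lhs => rw [← List.ofFn_get (p.roots.toList)]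
  rw [List.map_ofFn]
  rfl

theorem charEval_eq_prod {L : ℕ} {a : Fin L → ℝ} {z : Fin L → ℂ}
    (h : (filterPoly a).map (algebraMap ℝ ℂ) =
      ∏ i : Fin L, (Polynomial.X - Polynomial.C (z i))) (w : ℂ) :
    charEval a w = ∏ i, (w - z i) := by
  rw [← eval_filterPoly, h, Polynomial.eval_prod]
  simp

theorem mem_strictStable_iff {L : ℕ} {a : Fin L → ℝ} {z : Fin L → ℂ}
    (h : (filterPoly a).map (algebraMap ℝ ℂ) =
      ∏ i : Fin L, (Polynomial.X - Polynomial.C (z i))) :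
    a ∈ strictStable L ↔ ∀ i, ‖z i‖ < 1 := by
  simp only [strictStable, Set.mem_ofPred_eq, charEval_eq_prod h, Finset.prod_eq_zero_iff,
    Finset.mem_univ, true_and, sub_eq_zero]
  exact ⟨fun H i => H _ ⟨i, rfl⟩, fun H w ⟨i, hi⟩ => hi ▸ H i⟩

theorem strictStable_subset_stableSet (L : ℕ) : strictStable L ⊆ stableSet L 1 := by
  intro a ha
  obtain ⟨z, hz⟩ := exists_roots a
  exact ⟨z, fun i => ((mem_strictStable_iff hz).1 ha i).le, hz⟩

theorem revEval_eq {L : ℕ} (a : Fin L → ℝ) {z : ℂ} (hz : z ≠ 0) :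
    revEval a z = z ^ L * charEval a z⁻¹ := by
  rw [revEval, charEval, mul_add, inv_pow, mul_inv_cancel₀ (pow_ne_zero _ hz), Finset.mul_sum]
  congr 1
  refine Finset.sum_congr rfl fun i _ => ?_
  have h : z ^ L = z ^ (L - ((i : ℕ) + 1)) * z ^ ((i : ℕ) + 1) := by
    rw [← pow_add]; congr 1; omega
  rw [h, inv_pow]
  field_simp

theorem norm_revEval_conj {L : ℕ} (a : Fin L → ℝ) (z : ℂ) :
    ‖revEval a ((starRingEnd ℂ) z)‖ = ‖revEval a z‖ := by
  have : revEval a ((starRingEnd ℂ) z) = (starRingEnd ℂ) (revEval a z) := by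
    simp [revEval]
  rw [this, RCLike.norm_conj]

theorem revEval_eq_prod {L : ℕ} {a : Fin L → ℝ} {z : Fin L → ℂ}
    (h : (filterPoly a).map (algebraMap ℝ ℂ) =
      ∏ i : Fin L, (Polynomial.X - Polynomial.C (z i))) {w : ℂ} (hw : w ≠ 0) :
    revEval a w = ∏ i, (1 - w * z i) := by
  have : w ^ L = ∏ _i : Fin L, w := by simp
  rw [revEval_eq a hw, charEval_eq_prod h, this, ← Finset.prod_mul_distrib]
  refine Finset.prod_congr rfl fun i _ => ?_
  rw [mul_sub, mul_inv_cancel₀ hw]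

theorem norm_one_sub_le {w z : ℂ} (hw : 1 ≤ ‖w‖) (hz : ‖z‖ ≤ 1) :
    ‖1 - (starRingEnd ℂ) w * z‖ ≤ ‖w - z‖ := by
  have h1 : 1 ≤ ‖w‖ ^ 2 := one_le_pow₀ hw
  have h2 : ‖z‖ ^ 2 ≤ 1 := pow_le_one₀ (norm_nonneg _) hz
  refine (sq_le_sq₀ (norm_nonneg _) (norm_nonneg _)).1 ?_
  rw [Complex.sq_norm, Complex.normSq_apply] at *
  rw [Complex.sq_norm, Complex.normSq_apply] at *
  simp only [Complex.sub_re, Complex.one_re, Complex.mul_re, Complex.conj_re, Complex.conj_im,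
    Complex.sub_im, Complex.one_im, Complex.mul_im]
  nlinarith [mul_nonneg (sub_nonneg.2 h1) (sub_nonneg.2 h2)]

/-- Outside the open unit disc a stable filter polynomial dominates its reversal: the quotient is
a finite Blaschke product. -/
theorem norm_revEval_le {L : ℕ} {a : Fin L → ℝ} (ha : a ∈ strictStable L) {w : ℂ}
    (hw : 1 ≤ ‖w‖) : ‖revEval a w‖ ≤ ‖charEval a w‖ := by
  obtain ⟨z, hz⟩ := exists_roots a
  have hw0 : w ≠ 0 := by
    rintro rfl
    norm_num at hw
  rw [← norm_revEval_conj, revEval_eq_prod hz (by simpa using hw0), charEval_eq_prod hz,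
    norm_prod, norm_prod]
  exact Finset.prod_le_prod (fun _ _ => norm_nonneg _) fun i _ =>
    norm_one_sub_le hw ((mem_strictStable_iff hz).1 ha i).le

theorem charEval_zero {L : ℕ} (a : Fin (L + 1) → ℝ) : charEval a 0 = a (Fin.last L) := by
  rw [charEval, Fin.sum_univ_castSucc]
  rw [Finset.sum_eq_zero fun i _ => ?_]
  · simp
  · rw [zero_pow, mul_zero]
    have := i.2
    simp only [Fin.val_castSucc]
    omega

theorem abs_last_lt_one {L : ℕ} {a : Fin (L + 1) → ℝ} (ha : a ∈ strictStable (L + 1)) :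
    |a (Fin.last L)| < 1 := by
  obtain ⟨z, hz⟩ := exists_roots a
  have h := charEval_zero a
  rw [charEval_eq_prod hz] at h
  rw [← Real.norm_eq_abs, ← Complex.norm_real, ← h, norm_prod, Fin.prod_univ_castSucc]
  have h1 := (mem_strictStable_iff hz).1 ha
  refine lt_of_le_of_lt (mul_le_of_le_one_left (norm_nonneg _) ?_) (b := ‖0 - z (Fin.last L)‖) ?_
  · exact Finset.prod_le_one (fun _ _ => norm_nonneg _) fun i _ => by simpa using (h1 _).le
  · simpa using h1 _

/-- The last coefficient `k` and the step-down `b` of a filter `a` of order `L + 1` determine it: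
`a_i = b_i + k b_{L+1-i}`. -/
theorem eq_add_stepDown {L : ℕ} {a : Fin (L + 1) → ℝ} (h : 1 - a (Fin.last L) ^ 2 ≠ 0)
    (i : Fin L) :
    a i.castSucc = stepDown a i + a (Fin.last L) * stepDown a i.rev := by
  simp only [stepDown, Fin.rev_rev]
  field_simp
  ring

theorem charEval_succ {L : ℕ} {a : Fin (L + 1) → ℝ} (h : 1 - a (Fin.last L) ^ 2 ≠ 0) (z : ℂ) :
    charEval a z =
      z * charEval (stepDown a) z + a (Fin.last L) * revEval (stepDown a) z := by
  have h1 : ∑ i : Fin L, ((stepDown a i.rev : ℝ) : ℂ) * z ^ (L + 1 - ((i : ℕ) + 1)) =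
      ∑ i : Fin L, (stepDown a i : ℂ) * z ^ ((i : ℕ) + 1) := by
    rw [← Equiv.sum_comp Fin.revPerm]
    refine Finset.sum_congr rfl fun i _ => ?_
    have := i.2
    simp only [Fin.revPerm_apply, Fin.rev_rev, Fin.val_rev]
    congr 2
    omega
  have h2 : ∑ i : Fin L, ((stepDown a i : ℝ) : ℂ) * z ^ (L + 1 - ((i : ℕ) + 1)) =
      z * ∑ i : Fin L, (stepDown a i : ℂ) * z ^ (L - ((i : ℕ) + 1)) := by
    rw [Finset.mul_sum]
    refine Finset.sum_congr rfl fun i _ => ?_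
    have := i.2
    rw [show L + 1 - ((i : ℕ) + 1) = (L - ((i : ℕ) + 1)) + 1 by omega, pow_succ]
    ring
  rw [charEval, Fin.sum_univ_castSucc]
  simp only [eq_add_stepDown h, Fin.val_castSucc, Complex.ofReal_add, Complex.ofReal_mul, add_mul,
    Finset.sum_add_distrib, mul_assoc, ← Finset.mul_sum, h1, h2, Fin.val_last, Nat.sub_self,
    pow_zero, mul_one, charEval, revEval, mul_add, pow_succ]
  ring

theorem revEval_succ {L : ℕ} {a : Fin (L + 1) → ℝ} (h : 1 - a (Fin.last L) ^ 2 ≠ 0) (z : ℂ) :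
    revEval a z =
      revEval (stepDown a) z + a (Fin.last L) * (z * charEval (stepDown a) z) := by
  have h1 : ∑ i : Fin L, ((stepDown a i.rev : ℝ) : ℂ) * z ^ ((i : ℕ) + 1) =
      z * ∑ i : Fin L, (stepDown a i : ℂ) * z ^ (L - ((i : ℕ) + 1)) := by
    rw [← Equiv.sum_comp Fin.revPerm, Finset.mul_sum]
    refine Finset.sum_congr rfl fun i _ => ?_
    have := i.2
    simp only [Fin.revPerm_apply, Fin.rev_rev, Fin.val_rev]
    rw [pow_succ]
    ring
  rw [revEval, Fin.sum_univ_castSucc]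
  simp only [eq_add_stepDown h, Fin.val_castSucc, Complex.ofReal_add, Complex.ofReal_mul, add_mul,
    Finset.sum_add_distrib, mul_assoc, ← Finset.mul_sum, h1, Fin.val_last,
    charEval, revEval, mul_add]
  ring

theorem one_sub_sq_pos {k : ℝ} (h : |k| < 1) : 0 < 1 - k ^ 2 := by
  have := (sq_lt_one_iff_abs_lt_one k).2 h
  linarith

/-- The Schur–Cohn criterion: a filter is stable iff its last coefficient is in `(-1, 1)` and its
step-down is stable. -/
theorem mem_strictStable_succ_iff {L : ℕ} {a : Fin (L + 1) → ℝ} :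
    a ∈ strictStable (L + 1) ↔ |a (Fin.last L)| < 1 ∧ stepDown a ∈ strictStable L := by
  constructor
  · intro ha
    have hk := abs_last_lt_one ha
    have h0 := (one_sub_sq_pos hk).ne'
    refine ⟨hk, fun z hz => ?_⟩
    by_contra! hz1
    have h1 := charEval_succ h0 z
    have h2 := revEval_succ h0 z
    rw [hz, mul_zero] at h1 h2
    rw [zero_add] at h1
    rw [mul_zero, add_zero] at h2
    have h3 := norm_revEval_le ha hz1
    rw [h1, h2, norm_mul, Complex.norm_real, Real.norm_eq_abs] at h3
    have h4 : ‖revEval (stepDown a) z‖ = 0 := by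
      nlinarith [norm_nonneg (revEval (stepDown a) z)]
    rw [norm_eq_zero.1 h4, mul_zero] at h1
    exact absurd (ha z h1) (not_lt.2 hz1)
  · rintro ⟨hk, hb⟩ z hz
    by_contra! hz1
    rw [charEval_succ (one_sub_sq_pos hk).ne'] at hz
    have h3 := norm_revEval_le hb hz1
    have h4 : ‖z‖ * ‖charEval (stepDown a) z‖ =
        |a (Fin.last L)| * ‖revEval (stepDown a) z‖ := by
      rw [← norm_mul, eq_neg_of_add_eq_zero_left hz, norm_neg, norm_mul, Complex.norm_real,
        Real.norm_eq_abs]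
    have h5 : 0 < ‖charEval (stepDown a) z‖ := by
      rw [norm_pos_iff]
      exact fun h => absurd (hb z h) (not_lt.2 hz1)
    nlinarith [abs_nonneg (a (Fin.last L)), norm_nonneg (revEval (stepDown a) z)]

theorem measurable_stepDown (L : ℕ) : Measurable (stepDown : (Fin (L + 1) → ℝ) → Fin L → ℝ) := by
  unfold stepDown
  fun_prop

theorem measurable_reflCoeff (L : ℕ) : Measurable (reflCoeff : (Fin L → ℝ) → Fin L → ℝ) := by
  induction L with
  | zero => exact measurable_id
  | succ L ih =>
    refine measurable_pi_lambda _ fun i => ?_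
    induction i using Fin.lastCases with
    | last => simpa [reflCoeff] using measurable_pi_apply _
    | cast i =>
      have := (measurable_pi_apply i).comp (ih.comp (measurable_stepDown L))
      simpa [reflCoeff, Function.comp_def] using this

theorem measurableSet_strictStable (L : ℕ) : MeasurableSet (strictStable L) := by
  induction L with
  | zero =>
    have : strictStable 0 = Set.univ := by
      ext a
      simp [strictStable, charEval]
    simp [this]
  | succ L ih =>
    have : strictStable (L + 1) =
        {a | |a (Fin.last L)| < 1} ∩ stepDown ⁻¹' strictStable L := by
      ext a
      exact mem_strictStable_succ_iff
    rw [this]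
    exact (measurableSet_lt (by fun_prop) (by fun_prop)).inter (measurable_stepDown L ih)

/-- Multiplying `ψ_ℓ` by `r ^ ℓ` multiplies the roots of the filter by `r`. -/
theorem charEval_scale {L : ℕ} (a : Fin L → ℝ) {r : ℝ} (hr : r ≠ 0) (z : ℂ) :
    charEval (fun i => r ^ ((i : ℕ) + 1) * a i) z = (r : ℂ) ^ L * charEval a (z / r) := by
  have hr' : (r : ℂ) ≠ 0 := by exact_mod_cast hr
  rw [charEval, charEval, mul_add, div_pow, mul_div_cancel₀ _ (pow_ne_zero _ hr'), Finset.mul_sum]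
  congr 1
  refine Finset.sum_congr rfl fun i _ => ?_
  have h : (r : ℂ) ^ L = (r : ℂ) ^ (L - ((i : ℕ) + 1)) * (r : ℂ) ^ ((i : ℕ) + 1) := by
    rw [← pow_add]; congr 1; omega
  rw [h, div_pow]
  push_cast
  field_simp

theorem scale_mem_strictStable {L : ℕ} {a : Fin L → ℝ} (ha : a ∈ stableSet L 1) {r : ℝ}
    (hr0 : 0 < r) (hr : r < 1) : (fun i : Fin L => r ^ ((i : ℕ) + 1) * a i) ∈ strictStable L := by
  obtain ⟨z, hz1, hz⟩ := ha
  intro w hw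
  have hr' : (r : ℂ) ≠ 0 := by exact_mod_cast hr0.ne'
  rw [charEval_scale a hr0.ne', mul_eq_zero, or_iff_right (pow_ne_zero _ hr'),
    charEval_eq_prod hz, Finset.prod_eq_zero_iff] at hw
  obtain ⟨i, -, hi⟩ := hw
  have h1 : w = z i * r := by
    rw [← sub_eq_zero.1 hi]
    field_simp
  rw [h1, norm_mul, Complex.norm_real, Real.norm_eq_abs, abs_of_pos hr0]
  nlinarith [hz1 i, norm_nonneg (z i)]

/-! ### The Jacobian of the step-up map -/

/-- The matrix `1 + k J`, with `J` the order-reversing permutation, of the step-up map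
`b_i ↦ b_i + k b_{n+1-i}` for a fixed last coefficient `k`. -/
def stepUpMatrix (n : ℕ) (k : ℝ) : Matrix (Fin n) (Fin n) ℝ :=
  Matrix.of fun i j => (if i = j then 1 else 0) + k * (if i.rev = j then 1 else 0)

theorem stepUpMatrix_mulVec (n : ℕ) (k : ℝ) (b : Fin n → ℝ) (i : Fin n) :
    (stepUpMatrix n k).mulVec b i = b i + k * b i.rev := by
  simp [stepUpMatrix, Matrix.mulVec, dotProduct, add_mul, Finset.sum_add_distrib]

theorem stepUpMatrix_mul_neg (n : ℕ) (k : ℝ) :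
    stepUpMatrix n k * stepUpMatrix n (-k) = (1 - k ^ 2) • (1 : Matrix (Fin n) (Fin n) ℝ) := by
  refine Matrix.ext_of_mulVec_single fun j => ?_
  ext i
  rw [← Matrix.mulVec_mulVec]
  simp only [stepUpMatrix_mulVec, Fin.rev_rev, Matrix.smul_mulVec, Matrix.one_mulVec,
    Pi.smul_apply, smul_eq_mul]
  ring

theorem det_stepUpMatrix_mul_neg (n : ℕ) (k : ℝ) :
    (stepUpMatrix n k).det * (stepUpMatrix n (-k)).det = (1 - k ^ 2) ^ n := by
  rw [← Matrix.det_mul, stepUpMatrix_mul_neg, Matrix.det_smul, Matrix.det_one, mul_one,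
    Fintype.card_fin]

/-- A choice of signs which is opposite at `i` and `i.rev`, as long as these differ.
Conjugation by it turns `J` into `-J`, up to the entry of the middle index. -/
def halfSign (n : ℕ) (i : Fin n) : ℝ := if 2 * (i : ℕ) + 1 < n then 1 else -1

theorem halfSign_mul_self (n : ℕ) (i : Fin n) : halfSign n i * halfSign n i = 1 := by
  unfold halfSign
  split_ifs <;> norm_num

theorem halfSign_mul_rev {n : ℕ} {i : Fin n} (h : 2 * (i : ℕ) + 1 ≠ n) :
    halfSign n i * halfSign n i.rev = -1 := by
  have := i.2
  unfold halfSign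
  rw [Fin.val_rev]
  split_ifs <;> first | omega | norm_num

theorem det_conj_halfSign (n : ℕ) (M : Matrix (Fin n) (Fin n) ℝ) :
    (Matrix.of fun i j => halfSign n i * M i j * halfSign n j).det = M.det := by
  have h : (Matrix.of fun i j => halfSign n i * M i j * halfSign n j) =
      Matrix.diagonal (halfSign n) * M * Matrix.diagonal (halfSign n) := by
    ext i j
    simp [Matrix.mul_diagonal, Matrix.diagonal_mul]
  rw [h, Matrix.det_mul, Matrix.det_mul, Matrix.det_diagonal, mul_right_comm,
    ← Finset.prod_mul_distrib]
  simp [halfSign_mul_self]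

theorem conj_halfSign_apply {n : ℕ} (k : ℝ) {i : Fin n} (h : 2 * (i : ℕ) + 1 ≠ n) (j : Fin n) :
    halfSign n i * stepUpMatrix n k i j * halfSign n j = stepUpMatrix n (-k) i j := by
  have h1 := halfSign_mul_self n i
  have h2 := halfSign_mul_rev h
  simp only [stepUpMatrix, Matrix.of_apply]
  by_cases hij : i = j
  · have hr : i.rev ≠ i := by
      intro he
      have := congrArg Fin.val he
      rw [Fin.val_rev] at this
      have := i.2
      omega
    subst hij
    simp [hr, h1]
  · by_cases hr : i.rev = j
    · subst hr
      simp only [hij, if_false, if_true]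
      linear_combination k * h2
    · simp [hij, hr]

theorem det_stepUpMatrix_even {n : ℕ} (hn : Even n) (k : ℝ) :
    (stepUpMatrix n k).det = (stepUpMatrix n (-k)).det := by
  rw [← det_conj_halfSign]
  congr 1
  ext i j
  refine conj_halfSign_apply k ?_ j
  obtain ⟨m, rfl⟩ := hn
  omega

theorem det_stepUpMatrix_odd {n : ℕ} (hn : Odd n) (k : ℝ) :
    (1 - k) * (stepUpMatrix n k).det = (1 + k) * (stepUpMatrix n (-k)).det := by
  obtain ⟨m, rfl⟩ := hn
  -- The middle row of `1 ± k J` is `1 ± k` times a unit vector.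
  let c : Fin (2 * m + 1) := ⟨m, by omega⟩
  have hc : c.rev = c := by
    ext
    simp only [Fin.val_rev, c]
    omega
  have h1 : stepUpMatrix (2 * m + 1) (-k) =
      (stepUpMatrix (2 * m + 1) (-k)).updateRow c ((1 - k) • Pi.single c 1) := by
    ext i j
    rcases eq_or_ne i c with rfl | hi
    · rw [Matrix.updateRow_self]
      simp only [stepUpMatrix, Matrix.of_apply, hc, Pi.smul_apply, Pi.single_apply, smul_eq_mul,
        eq_comm (a := j)]
      split_ifs <;> ring
    · rw [Matrix.updateRow_ne hi]
  have h2 : (Matrix.of fun i j => halfSign (2 * m + 1) i * stepUpMatrix (2 * m + 1) k i j *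
      halfSign (2 * m + 1) j) =
      (stepUpMatrix (2 * m + 1) (-k)).updateRow c ((1 + k) • Pi.single c 1) := by
    ext i j
    rcases eq_or_ne i c with rfl | hi
    · rw [Matrix.updateRow_self]
      simp only [stepUpMatrix, Matrix.of_apply, hc, Pi.smul_apply, Pi.single_apply, smul_eq_mul,
        eq_comm (a := j)]
      split_ifs with h
      · subst h
        linear_combination (1 + k) * halfSign_mul_self (2 * m + 1) c
      · ring
    · rw [Matrix.updateRow_ne hi, Matrix.of_apply]
      refine conj_halfSign_apply k (fun h => hi ?_) j
      ext
      simp only [c]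
      omega
  rw [← det_conj_halfSign, h2, Matrix.det_updateRow_smul, h1, Matrix.det_updateRow_smul,
    Matrix.updateRow_idem]
  ring

/-- The density, up to a constant, of the `j`-th reflection coefficient (counted from `0`). -/
def reflWeight (j : ℕ) (k : ℝ) : ℝ := (1 + k) ^ ((j + 1) / 2) * (1 - k) ^ (j / 2)

theorem reflWeight_pos (j : ℕ) {k : ℝ} (hk : |k| < 1) : 0 < reflWeight j k := by
  have := abs_lt.1 hk
  exact mul_pos (pow_pos (by linarith) _) (pow_pos (by linarith) _)

theorem abs_det_stepUpMatrix (n : ℕ) {k : ℝ} (hk : |k| < 1) :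
    |(stepUpMatrix n k).det| = reflWeight n k := by
  have h0 := abs_lt.1 hk
  rw [← abs_of_pos (reflWeight_pos n hk), ← sq_eq_sq_iff_abs_eq_abs]
  have h := det_stepUpMatrix_mul_neg n k
  rcases Nat.even_or_odd n with hn | hn
  · rw [← det_stepUpMatrix_even hn] at h
    obtain ⟨m, rfl⟩ := hn
    rw [sq, h, reflWeight, show (m + m + 1) / 2 = m by omega, show (m + m) / 2 = m by omega,
      ← mul_pow, ← pow_mul]
    congr 1
    · ring
    · ring
  · have h1 := det_stepUpMatrix_odd hn k
    obtain ⟨m, rfl⟩ := hn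
    have h2 : (1 - k) ≠ 0 := by linarith
    apply mul_left_cancel₀ h2
    calc (1 - k) * (stepUpMatrix (2 * m + 1) k).det ^ 2
        = (1 + k) * ((stepUpMatrix (2 * m + 1) k).det * (stepUpMatrix (2 * m + 1) (-k)).det) := by
          linear_combination (stepUpMatrix (2 * m + 1) k).det * h1
      _ = _ := by
          rw [h, reflWeight, show (2 * m + 1 + 1) / 2 = m + 1 by omega,
            show (2 * m + 1) / 2 = m by omega,
            show 1 - k ^ 2 = (1 + k) * (1 - k) by ring, mul_pow]
          ring

/-! ### The law of the reflection coefficients -/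

/-- The measure on `(-1, 1)` with density `reflWeight j`. -/
noncomputable def reflMeasure (j : ℕ) : Measure ℝ :=
  (volume.restrict (Set.Ioo (-1) 1)).withDensity fun k => ENNReal.ofReal (reflWeight j k)

theorem measurable_reflWeight (j : ℕ) : Measurable (reflWeight j) := by
  unfold reflWeight
  fun_prop

theorem continuous_reflWeight (j : ℕ) : Continuous (reflWeight j) := by
  unfold reflWeight
  fun_prop

theorem reflMeasure_apply (j : ℕ) {s : Set ℝ} (hs : MeasurableSet s) :
    reflMeasure j s = ∫⁻ k in s ∩ Set.Ioo (-1) 1, ENNReal.ofReal (reflWeight j k) := by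
  rw [reflMeasure, withDensity_apply _ hs, Measure.restrict_restrict hs]

instance (j : ℕ) : IsFiniteMeasure (reflMeasure j) := by
  exact isFiniteMeasure_withDensity_ofReal (((continuous_reflWeight j).continuousOn.integrableOn_Icc (a := -1) (b := 1)).mono_set
    Set.Ioo_subset_Icc_self).2

theorem reflMeasure_univ_ne_zero (j : ℕ) : reflMeasure j Set.univ ≠ 0 := by
  rw [reflMeasure_apply j MeasurableSet.univ, Set.univ_inter, ← pos_iff_ne_zero,
    setLIntegral_pos_iff ((measurable_reflWeight j).ennreal_ofReal)]
  refine lt_of_lt_of_le ?_ (measure_mono (s := Set.Ioo (-1 : ℝ) 1) ?_)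
  · simp
  · intro k hk
    refine ⟨?_, hk⟩
    simpa using reflWeight_pos j (abs_lt.2 hk)

theorem volume_stepDown_preimage {L : ℕ} {k : ℝ} (hk : |k| < 1) (t : Set (Fin L → ℝ)) :
    volume {b : Fin L → ℝ | stepDown (Fin.snoc (α := fun _ => ℝ) b k) ∈ t} =
      ENNReal.ofReal (reflWeight L k) * volume t := by
  have h0 := (one_sub_sq_pos hk).ne'
  set f := Matrix.toLin' ((1 - k ^ 2)⁻¹ • stepUpMatrix L (-k)) with hf
  have h1 : {b : Fin L → ℝ | stepDown (Fin.snoc (α := fun _ => ℝ) b k) ∈ t} = f ⁻¹' t := by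
    ext b
    have : stepDown (Fin.snoc (α := fun _ => ℝ) b k) = f b := by
      ext i
      rw [hf, Matrix.toLin'_apply, Matrix.smul_mulVec, Pi.smul_apply, stepUpMatrix_mulVec]
      simp only [stepDown, Fin.snoc_castSucc, Fin.snoc_last, smul_eq_mul]
      field_simp
      ring
    simp [this]
  have h2 : (stepUpMatrix L k).det * LinearMap.det f = 1 := by
    rw [hf, LinearMap.det_toLin', ← Matrix.det_mul, Matrix.mul_smul, stepUpMatrix_mul_neg,
      smul_smul, inv_mul_cancel₀ h0, one_smul, Matrix.det_one]
  have h3 : LinearMap.det f ≠ 0 := right_ne_zero_of_mul_eq_one h2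
  rw [h1, Measure.addHaar_preimage_linearMap _ h3, ← eq_inv_of_mul_eq_one_left h2,
    abs_det_stepUpMatrix L hk]

theorem map_last_stepDown (L : ℕ) :
    (volume.restrict (strictStable (L + 1))).map (fun a => (a (Fin.last L), stepDown a)) =
      (reflMeasure L).prod (volume.restrict (strictStable L)) := by
  have hm : Measurable fun a : Fin (L + 1) → ℝ => (a (Fin.last L), stepDown a) :=
    (measurable_pi_apply _).prodMk (measurable_stepDown L)
  symm
  refine Measure.prod_eq fun s t hs ht => ?_
  have hI : MeasurableSet (s ∩ Set.Ioo (-1) 1) := hs.inter measurableSet_Ioo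
  have ht' : MeasurableSet (t ∩ strictStable L) := ht.inter (measurableSet_strictStable L)
  rw [Measure.map_apply hm (hs.prod ht), Measure.restrict_apply (hm (hs.prod ht)),
    Measure.restrict_apply ht, reflMeasure_apply L hs]
  set E : Set (Fin (L + 1) → ℝ) := (fun a => (a (Fin.last L), stepDown a)) ⁻¹'
    ((s ∩ Set.Ioo (-1) 1) ×ˢ (t ∩ strictStable L)) with hE
  have hE' : MeasurableSet E := hm (hI.prod ht')
  have h1 : (fun a : Fin (L + 1) → ℝ => (a (Fin.last L), stepDown a)) ⁻¹' (s ×ˢ t) ∩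
      strictStable (L + 1) = E := by
    ext a
    simp only [hE, Set.mem_inter_iff, Set.mem_preimage, Set.mem_prod, mem_strictStable_succ_iff,
      abs_lt, Set.mem_Ioo]
    tauto
  have he := (volume_preserving_piFinSuccAbove (fun _ : Fin (L + 1) => ℝ) (Fin.last L)).symm
  rw [h1, ← he.measure_preimage hE'.nullMeasurableSet, Measure.volume_eq_prod,
    Measure.prod_apply (he.measurable hE'), ← lintegral_mul_const _
      (measurable_reflWeight L).ennreal_ofReal, ← lintegral_indicator hI]
  refine lintegral_congr fun k => ?_
  have h2 : Prod.mk k ⁻¹' ((MeasurableEquiv.piFinSuccAbove (fun _ : Fin (L + 1) => ℝ)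
      (Fin.last L)).symm ⁻¹' E) = {b : Fin L → ℝ | k ∈ s ∩ Set.Ioo (-1) 1 ∧
        stepDown (Fin.snoc (α := fun _ => ℝ) b k) ∈ t ∩ strictStable L} := by
    ext b
    have h3 : (Fin.snocEquiv fun _ => ℝ) (k, b) = Fin.snoc (α := fun _ => ℝ) b k := rfl
    simp [hE, MeasurableEquiv.piFinSuccAbove, h3]
  rw [h2]
  by_cases hk : k ∈ s ∩ Set.Ioo (-1) 1
  · rw [Set.indicator_of_mem hk, ← volume_stepDown_preimage (abs_lt.2 hk.2)]
    simp [hk]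
  · rw [Set.indicator_of_notMem hk]
    simp [hk]

theorem map_reflCoeff (L : ℕ) :
    (volume.restrict (strictStable L)).map reflCoeff =
      Measure.pi fun i : Fin L => reflMeasure i := by
  induction L with
  | zero =>
    have h : strictStable 0 = Set.univ := by
      ext a
      simp [strictStable, charEval]
    have h1 : (reflCoeff : (Fin 0 → ℝ) → Fin 0 → ℝ) = id := by
      ext a i
      exact i.elim0
    rw [h, h1, Measure.restrict_univ, Measure.map_id, volume_pi]
    congr 1
    ext i
    exact i.elim0
  | succ L ih =>
    have he := (measurePreserving_piFinSuccAbove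
      (fun i : Fin (L + 1) => reflMeasure i) (Fin.last L)).symm
    have hm : Measurable fun a : Fin (L + 1) → ℝ => (a (Fin.last L), stepDown a) :=
      (measurable_pi_apply _).prodMk (measurable_stepDown L)
    have h1 : (reflCoeff : (Fin (L + 1) → ℝ) → Fin (L + 1) → ℝ) =
        (MeasurableEquiv.piFinSuccAbove (fun _ : Fin (L + 1) => ℝ) (Fin.last L)).symm ∘
          (Prod.map id reflCoeff) ∘ fun a => (a (Fin.last L), stepDown a) := by
      ext a i
      simp [reflCoeff, MeasurableEquiv.piFinSuccAbove]
    have : SFinite ((volume.restrict (strictStable L)).map reflCoeff) := by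
      rw [ih]
      infer_instance
    rw [← he.map_eq, h1, ← Measure.map_map he.measurable
      ((measurable_id.prodMap (measurable_reflCoeff L)).comp hm), ← Measure.map_map
      (measurable_id.prodMap (measurable_reflCoeff L)) hm, map_last_stepDown,
      ← Measure.map_prod_map _ _ measurable_id (measurable_reflCoeff L), ih, Measure.map_id]
    congr 1
    simp

theorem volume_strictStable (L : ℕ) :
    volume (strictStable L) = ∏ i : Fin L, reflMeasure i Set.univ := by
  rw [← Measure.pi_univ, ← map_reflCoeff, Measure.map_apply (measurable_reflCoeff L)
    MeasurableSet.univ]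
  simp

theorem volume_strictStable_ne_zero (L : ℕ) : volume (strictStable L) ≠ 0 := by
  rw [volume_strictStable]
  exact Finset.prod_ne_zero_iff.2 fun i _ => reflMeasure_univ_ne_zero i

theorem volume_strictStable_ne_top (L : ℕ) : volume (strictStable L) ≠ ∞ := by
  rw [volume_strictStable]
  exact ENNReal.prod_ne_top fun i _ => measure_ne_top _ _

/-- Shrinking the roots by a factor `r < 1` maps all filters with roots in the closed unit disc
to stable ones. Letting `r → 1` shows that roots on the unit circle have probability zero. -/
theorem volume_stableSet_le (L : ℕ) : volume (stableSet L 1) ≤ volume (strictStable L) := by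
  have key : ∀ r ∈ Set.Ioo (0 : ℝ) 1, volume (stableSet L 1) ≤
      ENNReal.ofReal |(∏ i : Fin L, r ^ ((i : ℕ) + 1))⁻¹| * volume (strictStable L) := by
    rintro r ⟨hr0, hr1⟩
    set f := Matrix.toLin' (Matrix.diagonal fun i : Fin L => r ^ ((i : ℕ) + 1)) with hf
    have h1 : LinearMap.det f = ∏ i : Fin L, r ^ ((i : ℕ) + 1) := by
      rw [hf, LinearMap.det_toLin', Matrix.det_diagonal]
    have h2 : LinearMap.det f ≠ 0 := by
      rw [h1]
      exact Finset.prod_ne_zero_iff.2 fun i _ => pow_ne_zero _ hr0.ne'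
    rw [← h1, ← Measure.addHaar_preimage_linearMap _ h2]
    refine measure_mono fun a ha => ?_
    have h3 : f a = fun i : Fin L => r ^ ((i : ℕ) + 1) * a i := by
      ext i
      rw [hf, Matrix.toLin'_apply, Matrix.mulVec_diagonal]
    rw [Set.mem_preimage, h3]
    exact scale_mem_strictStable ha hr0 hr1
  have hlim : Tendsto (fun r : ℝ =>
      ENNReal.ofReal |(∏ i : Fin L, r ^ ((i : ℕ) + 1))⁻¹| * volume (strictStable L))
      (𝓝[<] 1) (𝓝 (1 * volume (strictStable L))) := by
    refine ENNReal.Tendsto.mul_const ?_ (Or.inl one_ne_zero)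
    have hc : ContinuousAt (fun r : ℝ =>
        ENNReal.ofReal |(∏ i : Fin L, r ^ ((i : ℕ) + 1))⁻¹|) 1 := by
      refine ENNReal.continuous_ofReal.continuousAt.comp
        (continuous_abs.continuousAt.comp (ContinuousAt.inv₀ ?_ (by simp)))
      fun_prop
    have h := hc.tendsto
    simp only [one_pow, Finset.prod_const_one, inv_one, abs_one, ENNReal.ofReal_one] at h
    exact h.mono_left nhdsWithin_le_nhds
  rw [one_mul] at hlim
  refine ge_of_tendsto hlim ?_
  filter_upwards [Ioo_mem_nhdsLT (show (0 : ℝ) < 1 by norm_num)] with r hr using key r hr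

theorem strictStable_ae_eq (L : ℕ) : strictStable L =ᵐ[volume] stableSet L 1 :=
  ae_eq_of_subset_of_measure_ge (strictStable_subset_stableSet L) (volume_stableSet_le L)
    (measurableSet_strictStable L).nullMeasurableSet
    (ne_top_of_le_ne_top (volume_strictStable_ne_top L) (volume_stableSet_le L))

theorem cond_stableSet (L : ℕ) :
    volume[|stableSet L 1] = volume[|strictStable L] := by
  rw [ProbabilityTheory.cond, ProbabilityTheory.cond, Measure.restrict_congr_set (strictStable_ae_eq L),
    measure_congr (strictStable_ae_eq L)]

/-- The normalized version of `reflMeasure j`. -/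
noncomputable def reflLaw (j : ℕ) : Measure ℝ := (reflMeasure j Set.univ)⁻¹ • reflMeasure j

instance (j : ℕ) : IsProbabilityMeasure (reflLaw j) := by
  refine ⟨?_⟩
  rw [reflLaw, Measure.smul_apply, smul_eq_mul,
    ENNReal.inv_mul_cancel (reflMeasure_univ_ne_zero j) (measure_ne_top _ _)]

theorem map_reflCoeff_cond (L : ℕ) :
    (volume[|stableSet L 1]).map reflCoeff = Measure.pi fun i : Fin L => reflLaw i := by
  rw [cond_stableSet, ProbabilityTheory.cond, Measure.map_smul, map_reflCoeff, volume_strictStable]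
  symm
  refine Measure.pi_eq fun s hs => ?_
  simp only [reflLaw, Measure.smul_apply, smul_eq_mul, Measure.pi_pi, Finset.prod_mul_distrib]
  rw [ENNReal.prod_inv_distrib]
  intro i _ j _ _
  exact Or.inr (measure_ne_top _ _)

/-- For a uniformly distributed filter the reflection coefficients are independent. -/
theorem hasLaw_reflCoeff {Ω : Type*} [MeasurableSpace Ω] {P : Measure Ω} [IsProbabilityMeasure P]
    {L : ℕ} {Ψ : Ω → Fin L → ℝ} (h : pdf.IsUniform Ψ (stableSet L 1) P volume) :
    HasLaw (fun ω => reflCoeff (Ψ ω)) (Measure.pi fun i : Fin L => reflLaw i) P := by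
  have hS0 : volume (stableSet L 1) ≠ 0 := by
    rw [← measure_congr (strictStable_ae_eq L)]
    exact volume_strictStable_ne_zero L
  have hS1 : volume (stableSet L 1) ≠ ∞ := by
    rw [← measure_congr (strictStable_ae_eq L)]
    exact volume_strictStable_ne_top L
  have hΨ := h.aemeasurable hS0 hS1
  refine ⟨(measurable_reflCoeff L).comp_aemeasurable hΨ, ?_⟩
  rw [← map_reflCoeff_cond, ← h, AEMeasurable.map_map_of_aemeasurable
    (measurable_reflCoeff L).aemeasurable hΨ]
  rfl

theorem ae_mem_strictStable {Ω : Type*} [MeasurableSpace Ω] {P : Measure Ω}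
    {L : ℕ} {Ψ : Ω → Fin L → ℝ} (h : pdf.IsUniform Ψ (stableSet L 1) P volume) :
    ∀ᵐ ω ∂P, Ψ ω ∈ strictStable L := by
  have hS0 : volume (stableSet L 1) ≠ 0 := by
    rw [← measure_congr (strictStable_ae_eq L)]
    exact volume_strictStable_ne_zero L
  have hS1 : volume (stableSet L 1) ≠ ∞ := by
    rw [← measure_congr (strictStable_ae_eq L)]
    exact volume_strictStable_ne_top L
  refine ae_of_ae_map (h.aemeasurable hS0 hS1) (p := fun a => a ∈ strictStable L) ?_
  rw [h, cond_stableSet]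
  exact ae_cond_mem (measurableSet_strictStable L)

/-! ### The Levinson–Durbin recursion in an inner product space -/

section Levinson

variable {H : Type*} [NormedAddCommGroup H] [InnerProductSpace ℝ H]

/-- The residual `x₀ + ∑ c_ℓ x_{-ℓ}` of a linear one-step predictor. -/
def residual (x : ℤ → H) {L : ℕ} (c : Fin L → ℝ) : H :=
  x 0 + ∑ i : Fin L, c i • x (0 - (((i : ℕ) : ℤ) + 1))

/-- The normal equations: the residual is orthogonal to the values used for the prediction. -/
def IsNormalSol (x : ℤ → H) {L : ℕ} (c : Fin L → ℝ) : Prop :=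
  ∀ j : Fin L, inner ℝ (residual x c) (x (0 - (((j : ℕ) : ℤ) + 1))) = 0

/-- The second moments of a sequence of vectors are invariant under shifts. -/
def IsStationarySeq (x : ℤ → H) : Prop :=
  ∀ n k, inner ℝ (x (n + k)) (x n) = inner ℝ (x k) (x 0)

theorem IsStationarySeq.inner_eq {x : ℤ → H} (hx : IsStationarySeq x) {m n m' n' : ℤ}
    (h : m - n = n' - m') : inner ℝ (x m) (x n) = inner ℝ (x m') (x n') := by
  rw [real_inner_comm (x n') (x m')]
  have h1 := hx n (m - n)
  have h2 := hx m' (n' - m')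
  rw [add_sub_cancel] at h1 h2
  rw [h1, h2, h]

theorem inner_residual (x : ℤ → H) {L : ℕ} (c : Fin L → ℝ) (w : H) :
    inner ℝ (residual x c) w =
      inner ℝ (x 0) w + ∑ i, c i * inner ℝ (x (0 - (((i : ℕ) : ℤ) + 1))) w := by
  simp [residual, inner_add_left, sum_inner, real_inner_smul_left]

theorem norm_residual_sq {x : ℤ → H} {L : ℕ} {c : Fin L → ℝ} (hc : IsNormalSol x c) :
    ‖residual x c‖ ^ 2 = inner ℝ (residual x c) (x 0) := by
  rw [← real_inner_self_eq_norm_sq]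
  conv_lhs => rhs; rw [residual]
  rw [inner_add_right, inner_sum, Finset.sum_eq_zero, add_zero]
  intro i _
  rw [real_inner_smul_right, hc i, mul_zero]

/-- The backward residual of a predictor of order `L + 1`, which predicts `x_{-(L+1)}`
from the `L + 1` values after it. -/
def backwardResidual (x : ℤ → H) {L : ℕ} (c : Fin (L + 1) → ℝ) : H :=
  x (-(L + 1 : ℤ)) + ∑ i : Fin (L + 1), c i • x (((i : ℕ) : ℤ) - L)

/-- By stationarity the backward residual has the inner products of the forward one with the
time-reversed sequence. -/
theorem inner_backwardResidual {x : ℤ → H} (hx : IsStationarySeq x) {L : ℕ}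
    (c : Fin (L + 1) → ℝ) (m : ℤ) :
    inner ℝ (backwardResidual x c) (x m) =
      inner ℝ (residual x c) (x (-(L + 1 : ℤ) - m)) := by
  rw [inner_residual]
  simp only [backwardResidual, inner_add_left, sum_inner, real_inner_smul_left]
  congr 1
  · exact hx.inner_eq (by ring)
  · refine Finset.sum_congr rfl fun i _ => ?_
    rw [hx.inner_eq (m' := 0 - (((i : ℕ) : ℤ) + 1)) (n' := -(L + 1 : ℤ) - m) (by ring)]

theorem residual_sub_backwardResidual (x : ℤ → H) {L : ℕ} {c : Fin (L + 1) → ℝ}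
    (h : 1 - c (Fin.last L) ^ 2 ≠ 0) :
    residual x c - c (Fin.last L) • backwardResidual x c =
      (1 - c (Fin.last L) ^ 2) • residual x (stepDown c) := by
  have h1 : ∑ i : Fin L, c i.castSucc • x (((i : ℕ) : ℤ) - L) =
      ∑ i : Fin L, c i.rev.castSucc • x (0 - (((i : ℕ) : ℤ) + 1)) := by
    rw [← Equiv.sum_comp Fin.revPerm]
    refine Finset.sum_congr rfl fun i _ => ?_
    have := i.2
    simp only [Fin.revPerm_apply, Fin.val_rev]
    congr 2
    omega
  rw [residual, backwardResidual, residual, Fin.sum_univ_castSucc, Fin.sum_univ_castSucc]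
  simp only [Fin.val_castSucc, Fin.val_last, sub_self, h1]
  have h2 : (1 - c (Fin.last L) ^ 2) • ∑ i, stepDown c i • x (0 - (((i : ℕ) : ℤ) + 1)) =
      ∑ i : Fin L, c i.castSucc • x (0 - (((i : ℕ) : ℤ) + 1)) -
        c (Fin.last L) • ∑ i : Fin L, c i.rev.castSucc • x (0 - (((i : ℕ) : ℤ) + 1)) := by
    rw [Finset.smul_sum, Finset.smul_sum, ← Finset.sum_sub_distrib]
    refine Finset.sum_congr rfl fun i _ => ?_
    rw [smul_smul, smul_smul, ← sub_smul]
    congr 1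
    simp only [stepDown]
    field_simp
  rw [smul_add (1 - c (Fin.last L) ^ 2), h2, show (0 - ((L : ℤ) + 1)) = -(L + 1 : ℤ) by ring]
  module

theorem IsNormalSol.stepDown {x : ℤ → H} (hx : IsStationarySeq x) {L : ℕ}
    {c : Fin (L + 1) → ℝ} (hc : IsNormalSol x c) (h : 1 - c (Fin.last L) ^ 2 ≠ 0) :
    IsNormalSol x (stepDown c) := by
  intro j
  have := j.2
  refine (mul_eq_zero.1 ?_).resolve_left h
  rw [← real_inner_smul_left, ← residual_sub_backwardResidual x h, inner_sub_left,
    real_inner_smul_left, inner_backwardResidual hx]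
  have h1 := hc j.castSucc
  have h2 := hc j.rev.castSucc
  have h3 : (-(L + 1 : ℤ) - (0 - (((j : ℕ) : ℤ) + 1))) = 0 - (((j.rev : ℕ) : ℤ) + 1) := by
    rw [Fin.val_rev]
    omega
  simp only [Fin.val_castSucc] at h1 h2
  rw [h1, h3, h2, mul_zero, sub_zero]

theorem norm_residual_stepDown {x : ℤ → H} (hx : IsStationarySeq x) {L : ℕ}
    {c : Fin (L + 1) → ℝ} (hc : IsNormalSol x c) (h : 1 - c (Fin.last L) ^ 2 ≠ 0) :
    ‖residual x c‖ ^ 2 = (1 - c (Fin.last L) ^ 2) * ‖residual x (ARFilter.stepDown c)‖ ^ 2 := by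
  rw [norm_residual_sq hc, norm_residual_sq (hc.stepDown hx h), ← real_inner_smul_left,
    ← residual_sub_backwardResidual x h, inner_sub_left, real_inner_smul_left,
    inner_backwardResidual hx]
  have h1 := hc (Fin.last L)
  rw [Fin.val_last, zero_sub] at h1
  rw [sub_zero, h1, mul_zero, sub_zero]

/-- Iterating the step-down recursion yields the solutions of the normal equations of all orders
up to the order of a stable filter, with the reflection coefficients as last coefficients. -/
theorem exists_isNormalSol {x : ℤ → H} (hx : IsStationarySeq x) {L : ℕ} {a : Fin L → ℝ}
    (ha : a ∈ strictStable L) (hn : IsNormalSol x a) (i : Fin L) :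
    ∃ (c : Fin ((i : ℕ) + 1) → ℝ) (c' : Fin (i : ℕ) → ℝ), IsNormalSol x c ∧ IsNormalSol x c' ∧
      c (Fin.last i) = reflCoeff a i ∧
      ‖residual x c‖ ^ 2 = (1 - reflCoeff a i ^ 2) * ‖residual x c'‖ ^ 2 := by
  induction L with
  | zero => exact i.elim0
  | succ L ih =>
    have h := mem_strictStable_succ_iff.1 ha
    have h0 := (one_sub_sq_pos h.1).ne'
    induction i using Fin.lastCases with
    | last =>
      have hr : reflCoeff a (Fin.last L) = a (Fin.last L) := by simp [reflCoeff]
      rw [hr]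
      exact ⟨a, ARFilter.stepDown a, hn, hn.stepDown hx h0, rfl, norm_residual_stepDown hx hn h0⟩
    | cast i =>
      have hr : reflCoeff a i.castSucc = reflCoeff (ARFilter.stepDown a) i := by
        simp [reflCoeff]
      rw [hr]
      exact ih h.2 (hn.stepDown hx h0) i

/-- Pythagoras: the squared residual of an arbitrary predictor exceeds the one of a solution of
the normal equations by the squared norm of their difference. -/
theorem norm_residual_sq_eq_add {x : ℤ → H} {L : ℕ} {c : Fin L → ℝ} (hc : IsNormalSol x c)
    (c' : Fin L → ℝ) :
    ‖residual x c'‖ ^ 2 = ‖residual x c‖ ^ 2 +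
      ‖∑ i : Fin L, (c' i - c i) • x (0 - (((i : ℕ) : ℤ) + 1))‖ ^ 2 := by
  have h1 : residual x c' = residual x c +
      ∑ i : Fin L, (c' i - c i) • x (0 - (((i : ℕ) : ℤ) + 1)) := by
    simp only [residual, sub_smul, Finset.sum_sub_distrib]
    abel
  rw [h1, sq, sq, sq]
  refine norm_add_sq_eq_norm_sq_add_norm_sq_real ?_
  rw [inner_sum]
  refine Finset.sum_eq_zero fun i _ => ?_
  rw [real_inner_smul_right, hc i, mul_zero]

theorem IsNormalSol.norm_residual_le {x : ℤ → H} {L : ℕ} {c : Fin L → ℝ} (hc : IsNormalSol x c)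
    (c' : Fin L → ℝ) : ‖residual x c‖ ^ 2 ≤ ‖residual x c'‖ ^ 2 := by
  rw [norm_residual_sq_eq_add hc c']
  exact le_add_of_nonneg_right (sq_nonneg _)

/-- `ε` is a sequence of innovations of `x` of variance `v`: `ε_n` is orthogonal to the past of
`x`, and has inner product `v` with `x_n`. -/
structure IsInnovation (x ε : ℤ → H) (v : ℝ) : Prop where
  inner_of_lt : ∀ m n, m < n → inner ℝ (x m) (ε n) = 0
  inner_self : ∀ n, inner ℝ (x n) (ε n) = v

theorem IsInnovation.eq_zero_of_sum_eq_zero {x ε : ℤ → H} {v : ℝ} (h : IsInnovation x ε v)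
    (hv : v ≠ 0) {L : ℕ} {d : Fin L → ℝ}
    (hd : ∑ i : Fin L, d i • x (0 - (((i : ℕ) : ℤ) + 1)) = 0) : d = 0 := by
  have key : ∀ i : Fin L, d i = 0 := by
    intro i
    induction i using WellFoundedLT.induction with
    | _ i ih =>
      have h1 := congrArg (fun w => inner ℝ w (ε (0 - (((i : ℕ) : ℤ) + 1)))) hd
      simp only [sum_inner, real_inner_smul_left, inner_zero_left] at h1
      rw [Finset.sum_eq_single_of_mem i (Finset.mem_univ _), h.inner_self] at h1
      · exact (mul_eq_zero.1 h1).resolve_right hv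
      · intro j _ hj
        rcases lt_or_gt_of_ne hj with hlt | hgt
        · rw [ih j hlt, zero_mul]
        · rw [h.inner_of_lt _ _ (by have := Fin.lt_def.1 hgt; omega), mul_zero]
  exact funext key

theorem IsInnovation.eq_of_le {x ε : ℤ → H} {v : ℝ} (h : IsInnovation x ε v)
    (hv : v ≠ 0) {L : ℕ} {c c' : Fin L → ℝ} (hc : IsNormalSol x c)
    (hle : ‖residual x c'‖ ^ 2 ≤ ‖residual x c‖ ^ 2) : c' = c := by
  rw [norm_residual_sq_eq_add hc c'] at hle
  have h1 : ‖∑ i : Fin L, (c' i - c i) • x (0 - (((i : ℕ) : ℤ) + 1))‖ ^ 2 = 0 :=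
    le_antisymm (by linarith) (sq_nonneg _)
  rw [sq_eq_zero_iff, norm_eq_zero] at h1
  have h2 := h.eq_zero_of_sum_eq_zero hv (d := fun i => c' i - c i) h1
  ext i
  exact sub_eq_zero.1 (congrFun h2 i)

theorem IsInnovation.norm_residual_pos {x ε : ℤ → H} {v : ℝ} (h : IsInnovation x ε v)
    (hv : v ≠ 0) {L : ℕ} (c : Fin L → ℝ) : 0 < ‖residual x c‖ ^ 2 := by
  have h1 : inner ℝ (residual x c) (ε 0) = v := by
    rw [inner_residual, h.inner_self, Finset.sum_eq_zero, add_zero]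
    intro i _
    rw [h.inner_of_lt _ _ (by omega), mul_zero]
  have h2 : residual x c ≠ 0 := by
    intro h0
    rw [h0, inner_zero_left] at h1
    exact hv h1.symm
  positivity

theorem IsInnovation.isNormalSol {x ε : ℤ → H} {v : ℝ} (h : IsInnovation x ε v) {L : ℕ}
    {a : Fin L → ℝ} (ha : residual x a = ε 0) : IsNormalSol x a := by
  intro j
  rw [ha, real_inner_comm]
  exact h.inner_of_lt _ _ (by omega)

end Levinson

/-! ### Absolutely summable causal filters -/

section Causal

variable {E : Type*} [NormedAddCommGroup E] [NormedSpace ℝ E]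

/-- A power series with absolutely summable coefficients. -/
def IsAbsSummable {R : Type*} [NormedRing R] (f : PowerSeries R) : Prop :=
  Summable fun n => ‖PowerSeries.coeff n f‖

theorem IsAbsSummable.mul {R : Type*} [NormedRing R] {f g : PowerSeries R}
    (hf : IsAbsSummable f) (hg : IsAbsSummable g) : IsAbsSummable (f * g) := by
  simp only [IsAbsSummable, PowerSeries.coeff_mul]
  exact summable_norm_sum_mul_antidiagonal_of_summable_norm
    (f := fun n => PowerSeries.coeff n f) (g := fun n => PowerSeries.coeff n g) hf hg

/-- The causal filter `∑ f_k B ^ k`, with `B` the backward shift, applied to a sequence. -/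
noncomputable def causalFilter (f : PowerSeries ℝ) (y : ℤ → E) (n : ℤ) : E :=
  ∑' k : ℕ, PowerSeries.coeff k f • y (n - k)

theorem summable_causalFilter [CompleteSpace E] {f : PowerSeries ℝ} (hf : IsAbsSummable f)
    {y : ℤ → E} {C : ℝ} (hy : ∀ n, ‖y n‖ ≤ C) (n : ℤ) :
    Summable fun k : ℕ => PowerSeries.coeff k f • y (n - k) := by
  refine Summable.of_norm_bounded (hf.mul_right C) fun k => ?_
  rw [norm_smul]
  exact mul_le_mul_of_nonneg_left (hy _) (norm_nonneg _)

/-- Applying two causal filters in succession amounts to applying their Cauchy product. -/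
theorem causalFilter_mul [CompleteSpace E] {f g : PowerSeries ℝ} (hf : IsAbsSummable f)
    (hg : IsAbsSummable g) {y : ℤ → E} {C : ℝ} (hy : ∀ n, ‖y n‖ ≤ C) :
    causalFilter (f * g) y = causalFilter f (causalFilter g y) := by
  ext n
  let F : ℕ × ℕ → E := fun p =>
    PowerSeries.coeff p.1 f • PowerSeries.coeff p.2 g • y (n - p.1 - p.2)
  have hF : Summable F := by
    refine Summable.of_norm_bounded
      ((Summable.mul_of_nonneg hf hg (fun _ => norm_nonneg _) fun _ => norm_nonneg _).mul_right C)
      fun p => ?_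
    simp only [F]
    rw [norm_smul, norm_smul, ← mul_assoc]
    exact mul_le_mul_of_nonneg_left (hy _) (by positivity)
  have h1 : ∑' p, F p = causalFilter f (causalFilter g y) n := by
    rw [hF.tsum_prod]
    refine tsum_congr fun k => ?_
    simp only [F, causalFilter]
    exact tsum_const_smul'' _
  rw [← h1, ← Finset.HasAntidiagonal.sigmaAntidiagonalEquivProd.tsum_eq F]
  refine Eq.trans ?_ ((Finset.HasAntidiagonal.sigmaAntidiagonalEquivProd.summable_iff.2
    hF).tsum_sigma' fun n => (hasSum_fintype _).summable).symm
  refine tsum_congr fun k => ?_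
  rw [tsum_fintype, PowerSeries.coeff_mul, Finset.sum_smul]
  rw [← Finset.sum_finset_coe]
  refine Finset.sum_congr rfl fun p _ => ?_
  have hp := Finset.HasAntidiagonal.mem_antidiagonal.1 p.2
  simp only [F, Function.comp, Finset.HasAntidiagonal.sigmaAntidiagonalEquivProd_apply]
  rw [smul_smul]
  congr 2
  omega

theorem causalFilter_one (y : ℤ → E) : causalFilter 1 y = y := by
  ext n
  rw [causalFilter, tsum_eq_single 0]
  · simp
  · intro k hk
    simp [PowerSeries.coeff_one, hk]

/-- The power series `1 + ∑ ψ_ℓ z ^ ℓ` of an autoregressive filter. -/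
noncomputable def arSeries {L : ℕ} (a : Fin L → ℝ) : PowerSeries ℝ :=
  ((1 + ∑ i : Fin L, Polynomial.C (a i) * Polynomial.X ^ ((i : ℕ) + 1) : Polynomial ℝ) :
    PowerSeries ℝ)

theorem coeff_zero_arSeries {L : ℕ} (a : Fin L → ℝ) : PowerSeries.coeff 0 (arSeries a) = 1 := by
  rw [arSeries, Polynomial.coeff_coe]
  simp

theorem coeff_succ_arSeries {L : ℕ} (a : Fin L → ℝ) (i : Fin L) :
    PowerSeries.coeff ((i : ℕ) + 1) (arSeries a) = a i := by
  rw [arSeries, Polynomial.coeff_coe]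
  simp [Polynomial.coeff_X_pow, Polynomial.coeff_one,
    ← Fin.ext_iff]

theorem coeff_arSeries_of_lt {L : ℕ} (a : Fin L → ℝ) {k : ℕ} (hk : L < k) :
    PowerSeries.coeff k (arSeries a) = 0 := by
  rw [arSeries, Polynomial.coeff_coe, Polynomial.coeff_add, Polynomial.finsetSum_coeff,
    Finset.sum_eq_zero, Polynomial.coeff_one, if_neg (by omega), add_zero]
  intro i _
  rw [Polynomial.coeff_C_mul_X_pow, if_neg]
  have := i.2
  omega

theorem isAbsSummable_arSeries {L : ℕ} (a : Fin L → ℝ) : IsAbsSummable (arSeries a) := by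
  refine summable_of_ne_finset_zero (s := Finset.range (L + 1)) fun k hk => ?_
  rw [coeff_arSeries_of_lt a (by simpa using hk), norm_zero]

theorem causalFilter_arSeries {L : ℕ} (a : Fin L → ℝ) (y : ℤ → E) (n : ℤ) :
    causalFilter (arSeries a) y n =
      y n + ∑ i : Fin L, a i • y (n - (((i : ℕ) : ℤ) + 1)) := by
  rw [causalFilter, tsum_eq_sum (s := Finset.range (L + 1)), Finset.sum_range_succ',
    coeff_zero_arSeries, Finset.sum_range, add_comm]
  · simp [coeff_succ_arSeries]
  · intro k hk
    rw [coeff_arSeries_of_lt a (by simpa using hk), zero_smul]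

theorem isAbsSummable_geometric {z : ℂ} (hz : ‖z‖ < 1) :
    IsAbsSummable (PowerSeries.mk fun n => z ^ n) := by
  simpa [IsAbsSummable] using summable_geometric_of_lt_one (norm_nonneg z) hz

theorem geometric_mul (z : ℂ) :
    (PowerSeries.mk fun n => z ^ n) * (1 - PowerSeries.C z * PowerSeries.X) = 1 := by
  ext n
  rw [mul_sub, mul_one, mul_comm (PowerSeries.C z), ← mul_assoc, map_sub,
    PowerSeries.coeff_mul_C]
  cases n with
  | zero => simp
  | succ n => simp [PowerSeries.coeff_succ_mul_X, PowerSeries.coeff_one, pow_succ]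

theorem exists_inverse_prod {ι : Type*} (s : Finset ι) {z : ι → ℂ} (hz : ∀ i, ‖z i‖ < 1) :
    ∃ g : PowerSeries ℂ, IsAbsSummable g ∧
      g * ∏ i ∈ s, (1 - PowerSeries.C (z i) * PowerSeries.X) = 1 := by
  classical
  induction s using Finset.induction_on with
  | empty =>
    refine ⟨1, ?_, by simp⟩
    refine summable_of_ne_finset_zero (s := {0}) fun k hk => ?_
    rw [PowerSeries.coeff_one, if_neg (by simpa using hk), norm_zero]
  | insert i s hi ih =>
    obtain ⟨g, hg, hg1⟩ := ih
    refine ⟨(PowerSeries.mk fun n => z i ^ n) * g, (isAbsSummable_geometric (hz i)).mul hg, ?_⟩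
    rw [Finset.prod_insert hi, mul_mul_mul_comm, geometric_mul, hg1, one_mul]

theorem map_arSeries {L : ℕ} {a : Fin L → ℝ} {z : Fin L → ℂ}
    (h : (filterPoly a).map (algebraMap ℝ ℂ) =
      ∏ i : Fin L, (Polynomial.X - Polynomial.C (z i))) :
    PowerSeries.map (algebraMap ℝ ℂ) (arSeries a) =
      ∏ i, (1 - PowerSeries.C (z i) * PowerSeries.X) := by
  have h1 : (1 + ∑ i : Fin L, Polynomial.C (a i) * Polynomial.X ^ ((i : ℕ) + 1) :
      Polynomial ℝ).map (algebraMap ℝ ℂ) =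
      ∏ i, (1 - Polynomial.C (z i) * Polynomial.X) := by
    refine Polynomial.funext fun w => ?_
    rcases eq_or_ne w 0 with rfl | hw
    · simp [Polynomial.eval_prod, Polynomial.eval_finsetSum, Polynomial.map_sum]
    · have h2 := revEval_eq_prod h hw
      simpa [Polynomial.eval_prod, Polynomial.eval_finsetSum, Polynomial.map_sum, revEval,
        mul_comm w] using h2
  rw [arSeries, ← Polynomial.polynomial_map_coe, h1]
  rw [← Polynomial.coeToPowerSeries.ringHom_apply, map_prod]
  simp

/-- The power series of a stable filter has an absolutely summable inverse, since it is a product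
of factors `1 - z_i X` with `|z_i| < 1`. -/
theorem exists_inverse_arSeries {L : ℕ} {a : Fin L → ℝ} (ha : a ∈ strictStable L) :
    ∃ h : PowerSeries ℝ, IsAbsSummable h ∧ h * arSeries a = 1 := by
  obtain ⟨z, hz⟩ := exists_roots a
  obtain ⟨g, hg, hg1⟩ := exists_inverse_prod Finset.univ ((mem_strictStable_iff hz).1 ha)
  have h1 : (arSeries a)⁻¹ * arSeries a = 1 := by
    refine PowerSeries.inv_mul_cancel _ ?_
    rw [← PowerSeries.coeff_zero_eq_constantCoeff_apply, coeff_zero_arSeries]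
    exact one_ne_zero
  refine ⟨(arSeries a)⁻¹, ?_, h1⟩
  have h2 := congrArg (PowerSeries.map (algebraMap ℝ ℂ)) h1
  rw [map_mul, map_arSeries hz, map_one] at h2
  rw [← map_arSeries hz] at h2 hg1
  have h3 : PowerSeries.map (algebraMap ℝ ℂ) (arSeries a)⁻¹ = g := by
    refine left_inv_eq_right_inv h2 ?_
    rw [mul_comm, hg1]
  refine hg.congr fun n => ?_
  rw [← h3]
  simp

theorem coeff_zero_of_mul_arSeries {L : ℕ} {a : Fin L → ℝ} {h : PowerSeries ℝ}
    (hh : h * arSeries a = 1) : PowerSeries.coeff 0 h = 1 := by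
  have h1 := congrArg (PowerSeries.coeff 0) hh
  rwa [PowerSeries.coeff_mul, Finset.HasAntidiagonal.antidiagonal_zero, Finset.sum_singleton, coeff_zero_arSeries,
    mul_one, PowerSeries.coeff_zero_one] at h1

end Causal

section Innovation

variable {H : Type*} [NormedAddCommGroup H] [InnerProductSpace ℝ H]

theorem inner_causalFilter [CompleteSpace H] {f : PowerSeries ℝ} (hf : IsAbsSummable f) {y : ℤ → H} {C : ℝ}
    (hy : ∀ n, ‖y n‖ ≤ C) (n : ℤ) (w : H) :
    inner ℝ (causalFilter f y n) w = ∑' k : ℕ, PowerSeries.coeff k f * inner ℝ (y (n - k)) w := by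
  rw [real_inner_comm, ← innerSL_apply_apply ℝ, causalFilter,
    (innerSL ℝ w).map_tsum (summable_causalFilter hf hy n)]
  refine tsum_congr fun k => ?_
  rw [map_smul, innerSL_apply_apply, real_inner_comm, smul_eq_mul]

/-- Pairwise orthogonal vectors of squared norm `v`. -/
def IsWhiteNoiseSeq (ε : ℤ → H) (v : ℝ) : Prop :=
  ∀ m n, inner ℝ (ε m) (ε n) = if m = n then v else 0

theorem IsWhiteNoiseSeq.norm_le {ε : ℤ → H} {v : ℝ} (h : IsWhiteNoiseSeq ε v) (n : ℤ) :
    ‖ε n‖ ≤ √v := by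
  rw [norm_eq_sqrt_real_inner, h, if_pos rfl]

theorem IsWhiteNoiseSeq.isStationarySeq [CompleteSpace H] {ε : ℤ → H} {v : ℝ}
    (h : IsWhiteNoiseSeq ε v)
    {f : PowerSeries ℝ} (hf : IsAbsSummable f) : IsStationarySeq (causalFilter f ε) := by
  intro n k
  rw [inner_causalFilter hf h.norm_le, inner_causalFilter hf h.norm_le]
  refine tsum_congr fun i => ?_
  rw [real_inner_comm, inner_causalFilter hf h.norm_le, real_inner_comm,
    inner_causalFilter hf h.norm_le]
  congr 1
  refine tsum_congr fun j => ?_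
  rw [h, h]
  congr 2
  rw [eq_iff_iff]
  omega

/-- A bounded solution of the autoregressive recursion is the causal one. -/
theorem eq_causalFilter [CompleteSpace H] {L : ℕ} {a : Fin L → ℝ} {h : PowerSeries ℝ}
    (hh : IsAbsSummable h)
    (h1 : h * arSeries a = 1) {x ε : ℤ → H} {C : ℝ} (hx : ∀ n, ‖x n‖ ≤ C)
    (hrec : ∀ n, x n + ∑ i : Fin L, a i • x (n - (((i : ℕ) : ℤ) + 1)) = ε n) :
    x = causalFilter h ε := by
  have h2 : causalFilter (arSeries a) x = ε := by
    ext n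
    rw [causalFilter_arSeries, hrec]
  rw [← h2, ← causalFilter_mul hh (isAbsSummable_arSeries a) hx, h1, causalFilter_one]

theorem IsWhiteNoiseSeq.isInnovation [CompleteSpace H] {ε : ℤ → H} {v : ℝ} (h : IsWhiteNoiseSeq ε v)
    {f : PowerSeries ℝ} (hf : IsAbsSummable f) (hf0 : PowerSeries.coeff 0 f = 1) :
    IsInnovation (causalFilter f ε) ε v where
  inner_of_lt m n hmn := by
    rw [inner_causalFilter hf h.norm_le]
    refine (tsum_congr fun k => ?_).trans tsum_zero
    rw [h, if_neg (by omega), mul_zero]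
  inner_self n := by
    rw [inner_causalFilter hf h.norm_le, tsum_eq_single 0]
    · rw [h, if_pos (by simp), hf0, one_mul]
    · intro k hk
      rw [h, if_neg (by omega), mul_zero]

end Innovation

/-! ### Autoregressive processes as sequences in `L²` -/

section LpSequence

variable {Ω : Type*} [MeasurableSpace Ω] {P : Measure Ω}

theorem inner_toLp {f g : Ω → ℝ} (hf : MemLp f 2 P) (hg : MemLp g 2 P) :
    inner ℝ (hf.toLp f) (hg.toLp g) = ∫ ω, f ω * g ω ∂P := by
  rw [L2.inner_def]
  refine integral_congr_ae ?_
  filter_upwards [hf.coeFn_toLp, hg.coeFn_toLp] with ω h1 h2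
  rw [h1, h2, mul_comm]
  rfl

theorem memLp_of_hasLaw_gaussian {v : ℝ≥0} {f : Ω → ℝ} (h : HasLaw f (gaussianReal 0 v) P) :
    MemLp f 2 P := by
  have h1 : MemLp id 2 (gaussianReal 0 v) := memLp_id_gaussianReal 2
  rw [← h.map_eq] at h1
  exact (memLp_map_measure_iff (by fun_prop) h.aemeasurable).1 h1

theorem isWhiteNoiseSeq_toLp [IsProbabilityMeasure P] {v : ℝ≥0} {ε : ℤ → Ω → ℝ}
    (hε : ∀ n, HasLaw (ε n) (gaussianReal 0 v) P) (hi : iIndepFun ε P) :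
    IsWhiteNoiseSeq (fun n => (memLp_of_hasLaw_gaussian (hε n)).toLp (ε n)) v := by
  have h0 : ∀ n, ∫ ω, ε n ω ∂P = 0 := fun n => by
    rw [(hε n).integral_eq, integral_id_gaussianReal]
  intro m n
  rw [inner_toLp]
  split_ifs with h
  · subst h
    have h1 := (hε m).variance_eq
    rw [variance_id_gaussianReal, variance_of_integral_eq_zero (hε m).aemeasurable (h0 m)] at h1
    rw [← h1]
    simp [sq]
  · rw [(hi.indepFun h).integral_fun_mul_eq_mul_integral
      (hε m).aemeasurable.aestronglyMeasurable (hε n).aemeasurable.aestronglyMeasurable,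
      h0, zero_mul]

theorem coeFn_add_sum_smul (u : Lp ℝ 2 P) {L : ℕ} (w : Fin L → Lp ℝ 2 P) (c : Fin L → ℝ)
    {f : Ω → ℝ} (hf : u =ᵐ[P] f) {g : Fin L → Ω → ℝ} (hg : ∀ i, w i =ᵐ[P] g i) :
    (u + ∑ i, c i • w i : Lp ℝ 2 P) =ᵐ[P] fun ω => f ω + ∑ i, c i * g i ω := by
  have h1 : ∀ᵐ ω ∂P, ∀ i, (c i • w i : Lp ℝ 2 P) ω = c i * g i ω := by
    refine ae_all_iff.2 fun i => ?_
    filter_upwards [Lp.coeFn_smul (c i) (w i), hg i] with ω h2 h3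
    rw [h2, Pi.smul_apply, h3, smul_eq_mul]
  filter_upwards [h1, hf, Lp.coeFn_add u (∑ i, c i • w i),
    Lp.coeFn_finsetSum Finset.univ fun i => c i • w i] with ω h2 h3 h4 h5
  rw [h4, Pi.add_apply, h3, h5, Finset.sum_apply]
  simp only [h2]

theorem norm_sq_eq_integral {u : Lp ℝ 2 P} {f : Ω → ℝ} (hf : u =ᵐ[P] f) :
    ‖u‖ ^ 2 = ∫ ω, f ω ^ 2 ∂P := by
  rw [← real_inner_self_eq_norm_sq, L2.inner_def]
  refine integral_congr_ae ?_
  filter_upwards [hf] with ω h1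
  rw [h1, sq]
  rfl

theorem predMSE_eq {X : ℤ → Ω → ℝ} (hX : ∀ n, MemLp (X n) 2 P) {L : ℕ} (c : Fin L → ℝ) :
    predMSE P X c = ‖residual (fun n => (hX n).toLp (X n)) c‖ ^ 2 :=
  (norm_sq_eq_integral (coeFn_add_sum_smul _ _ c (hX _).coeFn_toLp
    fun i => (hX (0 - (((i : ℕ) : ℤ) + 1))).coeFn_toLp)).symm

theorem predErr_eq {X : ℤ → Ω → ℝ} (hX : ∀ n, MemLp (X n) 2 P) {L : ℕ} {c : Fin L → ℝ}
    (hc : IsNormalSol (fun n => (hX n).toLp (X n)) c) :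
    predErr P X L = ‖residual (fun n => (hX n).toLp (X n)) c‖ ^ 2 := by
  simp only [predErr, predMSE_eq hX]
  refine le_antisymm (ciInf_le ⟨0, ?_⟩ c) (le_ciInf fun c' => hc.norm_residual_le c')
  rintro _ ⟨c', rfl⟩
  positivity

theorem bestPredictor_eq {X : ℤ → Ω → ℝ} (hX : ∀ n, MemLp (X n) 2 P) {ε : ℤ → Lp ℝ 2 P} {v : ℝ}
    (hi : IsInnovation (fun n => (hX n).toLp (X n)) ε v) (hv : v ≠ 0) {L : ℕ} {c : Fin L → ℝ}
    (hc : IsNormalSol (fun n => (hX n).toLp (X n)) c) : bestPredictor P X L = c := by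
  have h1 : ∀ c', predMSE P X c ≤ predMSE P X c' := fun c' => by
    rw [predMSE_eq hX, predMSE_eq hX]
    exact hc.norm_residual_le c'
  have h2 := Classical.epsilon_spec (p := fun c : Fin L → ℝ =>
    ∀ c' : Fin L → ℝ, predMSE P X c ≤ predMSE P X c') ⟨c, h1⟩
  have h3 := h2 c
  rw [predMSE_eq hX, predMSE_eq hX] at h3
  exact hi.eq_of_le hv hc h3

/-- The partial autocorrelations and gains of a stationary autoregressive process with a stable
filter, up to the order of the filter. -/
theorem IsStationaryAR.pacf_and_gain [IsProbabilityMeasure P] {v : ℝ≥0} (hv : 0 < v) {L : ℕ}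
    {a : Fin L → ℝ} (ha : a ∈ strictStable L) {ε X : ℤ → Ω → ℝ} (h : IsStationaryAR P v a ε X)
    (i : Fin L) : pacf P X ((i : ℕ) + 1) = reflCoeff a i ∧
      gain P X ((i : ℕ) + 1) = -Real.log (1 - reflCoeff a i ^ 2) := by
  set x : ℤ → Lp ℝ 2 P := fun n => (h.memLp n).toLp (X n) with hx
  set e : ℤ → Lp ℝ 2 P := fun n => (memLp_of_hasLaw_gaussian (h.noise_law n)).toLp (ε n) with he
  have hst : IsStationarySeq x := by
    intro n k
    simp only [hx, inner_toLp]
    exact h.cov_stationary n k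
  have hrec : ∀ n, x n + ∑ i : Fin L, a i • x (n - (((i : ℕ) : ℤ) + 1)) = e n := by
    intro n
    refine Lp.ext ?_
    refine (coeFn_add_sum_smul _ _ a (h.memLp n).coeFn_toLp
      fun i => (h.memLp (n - (((i : ℕ) : ℤ) + 1))).coeFn_toLp).trans ?_
    filter_upwards [h.recursion n,
      (memLp_of_hasLaw_gaussian (h.noise_law n)).coeFn_toLp] with ω h1 h2
    rw [h1, h2]
  have hbd : ∀ n, ‖x n‖ ≤ ‖x 0‖ := by
    intro n
    refine (sq_le_sq₀ (norm_nonneg _) (norm_nonneg _)).1 ?_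
    rw [← real_inner_self_eq_norm_sq, ← real_inner_self_eq_norm_sq]
    exact (hst.inner_eq (by ring)).le
  obtain ⟨f, hf, hf1⟩ := exists_inverse_arSeries ha
  have hwn : IsWhiteNoiseSeq e v := isWhiteNoiseSeq_toLp h.noise_law h.noise_indep
  have hxe := eq_causalFilter hf hf1 hbd hrec
  have hin : IsInnovation x e v := by
    rw [hxe]
    exact hwn.isInnovation hf (coeff_zero_of_mul_arSeries hf1)
  have hv' : (v : ℝ) ≠ 0 := by exact_mod_cast hv.ne'
  have hn : IsNormalSol x a := hin.isNormalSol (hrec 0)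
  obtain ⟨c, c', hc, hc', h1, h2⟩ := exists_isNormalSol hst ha hn i
  constructor
  · rw [pacf, bestPredictor_eq h.memLp hin hv' hc, h1]
  · rw [gain, Nat.add_sub_cancel, predErr_eq h.memLp hc, predErr_eq h.memLp hc', h2,
      ← Real.log_inv]
    congr 1
    exact div_mul_cancel_right₀ (hin.norm_residual_pos hv' c').ne' _

end LpSequence

theorem isProbabilityMeasure_whiteNoise (v : ℝ≥0) : IsProbabilityMeasure (whiteNoise v) := by
  unfold whiteNoise
  infer_instance

/-- The stationary solution is obtained by applying to the noise the causal filter which inverts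
the autoregressive one. -/
theorem exists_isStationaryAR (v : ℝ≥0) {L : ℕ} {a : Fin L → ℝ} (ha : a ∈ strictStable L) :
    ∃ X : ℤ → (ℤ → ℝ) → ℝ, IsStationaryAR (whiteNoise v) v a (fun n w => w n) X := by
  have := isProbabilityMeasure_whiteNoise v
  have hlaw : ∀ n, HasLaw (fun w : ℤ → ℝ => w n) (gaussianReal 0 v) (whiteNoise v) := fun n =>
    (measurePreserving_eval_infinitePi (fun _ : ℤ => gaussianReal 0 v) n).hasLaw
  have hind : iIndepFun (fun (n : ℤ) (w : ℤ → ℝ) => w n) (whiteNoise v) :=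
    iIndepFun_infinitePi (P := fun _ : ℤ => gaussianReal 0 v) (X := fun _ => id)
      (fun _ => measurable_id)
  set e : ℤ → Lp ℝ 2 (whiteNoise v) := fun n =>
    (memLp_of_hasLaw_gaussian (hlaw n)).toLp (fun w => w n) with he
  have hwn : IsWhiteNoiseSeq e v := isWhiteNoiseSeq_toLp hlaw hind
  obtain ⟨f, hf, hf1⟩ := exists_inverse_arSeries ha
  set x := causalFilter f e with hx
  have hinner : ∀ m n, ∫ w, x m w * x n w ∂(whiteNoise v) = inner ℝ (x m) (x n) := by
    intro m n
    rw [← inner_toLp (Lp.memLp (x m)) (Lp.memLp (x n)), Lp.toLp_coeFn, Lp.toLp_coeFn]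
  refine ⟨fun n => x n, hlaw, hind, fun n => Lp.memLp (x n), fun n => ?_, fun n k => ?_,
    fun n => ?_⟩
  · -- The mean is the inner product with the constant function `1`.
    have h1 : MemLp (fun _ : ℤ → ℝ => (1 : ℝ)) 2 (whiteNoise v) := memLp_const 1
    have h2 : ∀ n, ∫ w, x n w ∂(whiteNoise v) = 0 := by
      intro n
      have h3 : ∫ w, x n w ∂(whiteNoise v) = inner ℝ (x n) (h1.toLp _) := by
        conv_rhs => rw [← Lp.toLp_coeFn (x n) (Lp.memLp (x n))]
        rw [inner_toLp]
        simp
      rw [h3, hx, inner_causalFilter hf hwn.norm_le]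
      refine (tsum_congr fun k => ?_).trans tsum_zero
      rw [he, inner_toLp]
      simp only [mul_one]
      rw [(hlaw _).integral_eq, integral_id_gaussianReal, mul_zero]
    rw [h2, h2]
  · rw [hinner, hinner]
    exact hwn.isStationarySeq hf n k
  · have h1 : causalFilter (arSeries a) x = e := by
      rw [hx, ← causalFilter_mul (isAbsSummable_arSeries a) hf hwn.norm_le, mul_comm, hf1,
        causalFilter_one]
    have h2 := congrFun h1 n
    rw [causalFilter_arSeries] at h2
    have h3 := coeFn_add_sum_smul (x n) (fun i : Fin L => x (n - (((i : ℕ) : ℤ) + 1))) a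
      (ae_eq_refl _) fun i => ae_eq_refl _
    rw [h2] at h3
    filter_upwards [h3, (memLp_of_hasLaw_gaussian (hlaw n)).coeFn_toLp] with w h4 h5
    rw [← h4, h5]

theorem filterPacf_and_filterGain {v : ℝ≥0} (hv : 0 < v) {L : ℕ} {a : Fin L → ℝ}
    (ha : a ∈ strictStable L) (i : Fin L) :
    filterPacf v a ((i : ℕ) + 1) = reflCoeff a i ∧
      filterGain v a ((i : ℕ) + 1) = -Real.log (1 - reflCoeff a i ^ 2) := by
  have := isProbabilityMeasure_whiteNoise v
  exact IsStationaryAR.pacf_and_gain hv ha (Classical.epsilon_spec (exists_isStationaryAR v ha)) i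

/-! ### The beta law of a reflection coefficient -/

/-- The affine substitution `k = 2 x - 1` turns `reflWeight j` into a beta density, up to a
constant factor. -/
theorem indicator_reflWeight (j : ℕ) (k : ℝ) :
    (Set.Ioo (-1 : ℝ) 1).indicator (fun k => ENNReal.ofReal (reflWeight j k)) k =
      ENNReal.ofReal (2 ^ ((j + 1) / 2 + j / 2) *
        beta (((j + 1) / 2 + 1 : ℕ) : ℝ) ((j / 2 + 1 : ℕ) : ℝ)) *
        betaPDF (((j + 1) / 2 + 1 : ℕ) : ℝ) ((j / 2 + 1 : ℕ) : ℝ) ((k + 1) / 2) := by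
  have hB : 0 < beta (((j + 1) / 2 + 1 : ℕ) : ℝ) ((j / 2 + 1 : ℕ) : ℝ) :=
    beta_pos (by positivity) (by positivity)
  by_cases hk : k ∈ Set.Ioo (-1 : ℝ) 1
  · have hk' : 0 < (k + 1) / 2 ∧ (k + 1) / 2 < 1 :=
      ⟨by linarith [hk.1], by linarith [hk.2]⟩
    rw [Set.indicator_of_mem hk, betaPDF_of_pos_lt_one hk'.1 hk'.2,
      ← ENNReal.ofReal_mul (by positivity)]
    congr 1
    rw [Nat.cast_succ, Nat.cast_succ, add_sub_cancel_right, add_sub_cancel_right,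
      Real.rpow_natCast, Real.rpow_natCast, reflWeight,
      show 1 + k = 2 * ((k + 1) / 2) by ring, show 1 - k = 2 * (1 - (k + 1) / 2) by ring,
      mul_pow, mul_pow, pow_add]
    rw [Nat.cast_succ, Nat.cast_succ] at hB
    field_simp
  · rw [Set.indicator_of_notMem hk]
    have hk' : ¬ (0 < (k + 1) / 2 ∧ (k + 1) / 2 < 1) := fun h =>
      hk ⟨by linarith [h.1], by linarith [h.2]⟩
    rw [betaPDF_eq, if_neg hk', ENNReal.ofReal_zero, mul_zero]

theorem map_volume_affine :
    (volume : Measure ℝ).map (fun k => (k + 1) / 2) = ENNReal.ofReal 2 • volume := by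
  have h1 : (fun k : ℝ => (k + 1) / 2) = (fun x => x * (1 / 2)) ∘ fun k => k + 1 := by
    ext k
    simp only [Function.comp]
    ring
  rw [h1, ← Measure.map_map (by fun_prop) (by fun_prop), map_add_right_eq_self,
    Real.map_volume_mul_right (by norm_num)]
  norm_num

theorem map_reflMeasure (j : ℕ) : ∃ C : ℝ≥0∞, (reflMeasure j).map (fun k => (k + 1) / 2) =
    C • betaMeasure (((j + 1) / 2 + 1 : ℕ) : ℝ) ((j / 2 + 1 : ℕ) : ℝ) := by
  have hpdf : Measurable (betaPDF (((j + 1) / 2 + 1 : ℕ) : ℝ) ((j / 2 + 1 : ℕ) : ℝ)) :=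
    (measurable_betaPDFReal _ _).ennreal_ofReal
  set D := ENNReal.ofReal (2 ^ ((j + 1) / 2 + j / 2) *
        beta (((j + 1) / 2 + 1 : ℕ) : ℝ) ((j / 2 + 1 : ℕ) : ℝ)) with hD
  refine ⟨ENNReal.ofReal 2 * D, ?_⟩
  have hφ : Measurable fun k : ℝ => (k + 1) / 2 := by fun_prop
  ext A hA
  rw [Measure.map_apply hφ hA, reflMeasure_apply j (hφ hA), Measure.smul_apply, betaMeasure,
    withDensity_apply _ hA, ← lintegral_indicator hA, smul_eq_mul, mul_assoc,
    ← lintegral_const_mul _ (hpdf.indicator hA), ← smul_eq_mul (ENNReal.ofReal 2),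
    ← lintegral_smul_measure, ← map_volume_affine,
    lintegral_map ((hpdf.indicator hA).const_mul _) hφ,
    ← lintegral_indicator ((hφ hA).inter measurableSet_Ioo), Set.inter_comm]
  refine lintegral_congr fun k => ?_
  rw [Set.inter_comm, ← Set.indicator_indicator]
  by_cases hk : k ∈ (fun k : ℝ => (k + 1) / 2) ⁻¹' A
  · rw [Set.indicator_of_mem hk, indicator_reflWeight, Set.indicator_of_mem (by exact hk)]
  · rw [Set.indicator_of_notMem hk, Set.indicator_of_notMem (by exact hk), mul_zero]

theorem map_reflLaw (j : ℕ) : (reflLaw j).map (fun k => (k + 1) / 2) =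
    betaMeasure (((j + 1) / 2 + 1 : ℕ) : ℝ) ((j / 2 + 1 : ℕ) : ℝ) := by
  obtain ⟨C, hC⟩ := map_reflMeasure j
  have := isProbabilityMeasureBeta (α := (((j + 1) / 2 + 1 : ℕ) : ℝ))
    (β := ((j / 2 + 1 : ℕ) : ℝ)) (by positivity) (by positivity)
  have h1 : reflMeasure j Set.univ = C := by
    have h2 := congrArg (fun μ : Measure ℝ => μ Set.univ) hC
    simp only [Measure.smul_apply, smul_eq_mul, measure_univ, mul_one] at h2
    rwa [Measure.map_apply (by fun_prop) MeasurableSet.univ, Set.preimage_univ] at h2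
  rw [reflLaw, Measure.map_smul, hC, smul_smul, ← h1,
    ENNReal.inv_mul_cancel (reflMeasure_univ_ne_zero j) (measure_ne_top _ _), one_smul]

/-! ### The chi-square limit -/

theorem integral_reflLaw (j : ℕ) (f : ℝ → ℝ) :
    ∫ k, f k ∂(reflLaw j) =
      (∫ k in Set.Ioo (-1) 1, reflWeight j k * f k) /
        ∫ k in Set.Ioo (-1) 1, reflWeight j k := by
  have h : ∀ g : ℝ → ℝ, ∫ k, g k ∂(reflMeasure j) =
      ∫ k in Set.Ioo (-1) 1, reflWeight j k * g k := by
    intro g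
    rw [reflMeasure, integral_withDensity_eq_integral_toReal_smul
      (measurable_reflWeight j).ennreal_ofReal (ae_of_all _ fun _ => ENNReal.ofReal_lt_top)]
    refine setIntegral_congr_fun measurableSet_Ioo fun k hk => ?_
    simp only [smul_eq_mul]
    rw [ENNReal.toReal_ofReal (reflWeight_pos j (abs_lt.2 hk)).le]
  have h1 : (reflMeasure j Set.univ).toReal = ∫ k in Set.Ioo (-1) 1, reflWeight j k := by
    have := h fun _ => 1
    simpa [Measure.real] using this
  rw [reflLaw, integral_smul_measure, h, ENNReal.toReal_inv, h1, smul_eq_mul, div_eq_inv_mul]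

/-- The unnormalized density of `√(j + 1)` times the `j`-th reflection coefficient. -/
noncomputable def scaledWeight (j : ℕ) (x : ℝ) : ℝ :=
  (Set.Ioo (-1) 1).indicator (reflWeight j) (x / √(j + 1))

theorem integral_reflLaw_eq_scaled (j : ℕ) (f : ℝ → ℝ) :
    ∫ k, f k ∂(reflLaw j) =
      (∫ x, scaledWeight j x * f (x / √(j + 1))) / ∫ x, scaledWeight j x := by
  have hs : |√((j : ℝ) + 1)| ≠ 0 := by positivity
  have h : ∀ g : ℝ → ℝ, ∫ x, scaledWeight j x * g (x / √(j + 1)) =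
      |√((j : ℝ) + 1)| * ∫ k in Set.Ioo (-1) 1, reflWeight j k * g k := by
    intro g
    rw [← integral_indicator measurableSet_Ioo, ← smul_eq_mul, ← Measure.integral_comp_div]
    refine integral_congr_ae (ae_of_all _ fun x => ?_)
    simp only [scaledWeight]
    by_cases hx : x / √(j + 1) ∈ Set.Ioo (-1 : ℝ) 1
    · rw [Set.indicator_of_mem hx, Set.indicator_of_mem hx]
    · rw [Set.indicator_of_notMem hx, Set.indicator_of_notMem hx, zero_mul]
  have h1 := h fun _ => 1
  simp only [mul_one] at h1
  rw [h, h1, integral_reflLaw, mul_div_mul_left _ _ hs]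

theorem reflWeight_eq (j : ℕ) (k : ℝ) :
    reflWeight j k = (1 - k ^ 2) ^ (j / 2) * (1 + k) ^ (j % 2) := by
  rw [reflWeight, show (j + 1) / 2 = j / 2 + j % 2 by omega, pow_add,
    show 1 - k ^ 2 = (1 + k) * (1 - k) by ring, mul_pow]
  ring

theorem scaledWeight_nonneg (j : ℕ) (x : ℝ) : 0 ≤ scaledWeight j x :=
  Set.indicator_nonneg (fun _ hk => (reflWeight_pos j (abs_lt.2 hk)).le) _

/-- A Gaussian bound, uniform in `j`. -/
theorem scaledWeight_le (j : ℕ) (x : ℝ) :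
    scaledWeight j x ≤ 2 * Real.exp 1 * Real.exp (-(1 / 2) * x ^ 2) := by
  rw [scaledWeight]
  by_cases hx : x / √(j + 1) ∈ Set.Ioo (-1 : ℝ) 1
  · rw [Set.indicator_of_mem hx, reflWeight_eq]
    have hk : x ^ 2 = (x / √(j + 1)) ^ 2 * ((j : ℝ) + 1) := by
      rw [div_pow, Real.sq_sqrt (by positivity)]
      field_simp
    set k := x / √(j + 1) with hk_def
    have hk1 : k ^ 2 < 1 := (sq_lt_one_iff_abs_lt_one k).2 (abs_lt.2 hx)
    have h1 : (1 - k ^ 2) ^ (j / 2) ≤ Real.exp 1 * Real.exp (-(1 / 2) * x ^ 2) := by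
      calc (1 - k ^ 2) ^ (j / 2) ≤ Real.exp (-k ^ 2) ^ (j / 2) := by
            refine pow_le_pow_left₀ (by linarith) ?_ _
            linarith [Real.add_one_le_exp (-k ^ 2)]
        _ = Real.exp ((j / 2 : ℕ) * (-k ^ 2)) := by rw [Real.exp_nat_mul]
        _ ≤ Real.exp (1 + -(1 / 2) * x ^ 2) := by
            refine Real.exp_le_exp.2 ?_
            have hj : (j : ℝ) ≤ 2 * ((j / 2 : ℕ) : ℝ) + 1 := by
              exact_mod_cast (by omega : j ≤ 2 * (j / 2) + 1)
            rw [hk]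
            nlinarith [sq_nonneg k]
        _ = _ := Real.exp_add _ _
    have h2 : (1 + k) ^ (j % 2) ≤ 2 := by
      rcases Nat.mod_two_eq_zero_or_one j with h | h
      · rw [h, pow_zero]
        norm_num
      · rw [h, pow_one]
        linarith [hx.2]
    have h3 : 0 ≤ (1 + k) ^ (j % 2) := pow_nonneg (by linarith [hx.1]) _
    calc _ ≤ Real.exp 1 * Real.exp (-(1 / 2) * x ^ 2) * 2 := mul_le_mul h1 h2 h3 (by positivity)
      _ = _ := by ring
  · rw [Set.indicator_of_notMem hx]
    positivity

theorem measurable_scaledWeight (j : ℕ) : Measurable (scaledWeight j) :=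
  ((measurable_reflWeight j).indicator measurableSet_Ioo).comp (by fun_prop)

theorem tendsto_mul_log_one_sub (x : ℝ) :
    Tendsto (fun j : ℕ => ((j : ℝ) + 1) * Real.log (1 - (x / √(j + 1)) ^ 2)) atTop
      (𝓝 (-x ^ 2)) := by
  have h1 : Tendsto (fun t : ℝ => t * (-x ^ 2 / t)) atTop (𝓝 (-x ^ 2)) := by
    refine tendsto_const_nhds.congr' ?_
    filter_upwards [eventually_ne_atTop 0] with t ht
    field_simp
  have h2 := (Real.tendsto_mul_log_one_add_of_tendsto h1).comp
    (tendsto_atTop_add_const_right _ (1 : ℝ) (tendsto_natCast_atTop_atTop (R := ℝ)))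
  refine h2.congr fun j => ?_
  simp only [Function.comp]
  rw [div_pow, Real.sq_sqrt (by positivity)]
  congr 2
  ring

theorem tendsto_half_div : Tendsto (fun j : ℕ => ((j / 2 : ℕ) : ℝ) / ((j : ℝ) + 1)) atTop
    (𝓝 (1 / 2)) := by
  have h1 : Tendsto (fun j : ℕ => (1 / 2 : ℝ) - 1 / ((j : ℝ) + 1)) atTop (𝓝 (1 / 2)) := by
    simpa using tendsto_const_nhds.sub (tendsto_one_div_add_atTop_nhds_zero_nat (𝕜 := ℝ))
  refine tendsto_of_tendsto_of_tendsto_of_le_of_le h1 tendsto_const_nhds (fun j => ?_)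
    fun j => ?_
  · have hj : (j : ℝ) ≤ 2 * ((j / 2 : ℕ) : ℝ) + 1 := by
      exact_mod_cast (by omega : j ≤ 2 * (j / 2) + 1)
    have hp : (0 : ℝ) < (j : ℝ) + 1 := by positivity
    rw [le_div_iff₀ hp, sub_mul, one_div_mul_cancel hp.ne']
    linarith
  · have hj : 2 * ((j / 2 : ℕ) : ℝ) ≤ (j : ℝ) := by
      exact_mod_cast (by omega : 2 * (j / 2) ≤ j)
    have hp : (0 : ℝ) < (j : ℝ) + 1 := by positivity
    rw [div_le_iff₀ hp]
    linarith

theorem tendsto_div_sqrt (x : ℝ) :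
    Tendsto (fun j : ℕ => x / √((j : ℝ) + 1)) atTop (𝓝 0) :=
  tendsto_const_nhds.div_atTop (Real.tendsto_sqrt_atTop.comp
    (tendsto_atTop_add_const_right _ (1 : ℝ) (tendsto_natCast_atTop_atTop (R := ℝ))))

theorem tendsto_scaledWeight (x : ℝ) :
    Tendsto (fun j => scaledWeight j x) atTop (𝓝 (Real.exp (-(1 / 2) * x ^ 2))) := by
  have h0 := tendsto_div_sqrt x
  have h1 : Tendsto (fun j : ℕ => (1 + x / √((j : ℝ) + 1)) ^ (j % 2)) atTop (𝓝 1) := by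
    have h2 : Tendsto (fun j : ℕ => 1 + |x / √((j : ℝ) + 1)|) atTop (𝓝 1) := by
      simpa using tendsto_const_nhds.add h0.abs
    have h3 : Tendsto (fun j : ℕ => 1 - |x / √((j : ℝ) + 1)|) atTop (𝓝 1) := by
      simpa using tendsto_const_nhds.sub h0.abs
    refine tendsto_of_tendsto_of_tendsto_of_le_of_le h3 h2 (fun j => ?_) fun j => ?_
    all_goals
      rcases Nat.mod_two_eq_zero_or_one j with h | h
      · simp only [h, pow_zero]
        linarith [abs_nonneg (x / √((j : ℝ) + 1))]
      · simp only [h, pow_one]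
        linarith [neg_abs_le (x / √((j : ℝ) + 1)), le_abs_self (x / √((j : ℝ) + 1))]
  have h2 : Tendsto (fun j : ℕ => Real.exp (((j / 2 : ℕ) : ℝ) / ((j : ℝ) + 1) *
      (((j : ℝ) + 1) * Real.log (1 - (x / √(j + 1)) ^ 2)))) atTop
      (𝓝 (Real.exp (-(1 / 2) * x ^ 2))) := by
    refine (Real.continuous_exp.tendsto _).comp ?_
    have := tendsto_half_div.mul (tendsto_mul_log_one_sub x)
    rwa [show (1 / 2 : ℝ) * -x ^ 2 = -(1 / 2) * x ^ 2 by ring] at this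
  have h3 := h2.mul h1
  rw [mul_one] at h3
  refine h3.congr' ?_
  filter_upwards [h0.eventually (Ioo_mem_nhds (show (-1 : ℝ) < 0 by norm_num) one_pos)] with j hj'
  have hj : x / √((j : ℝ) + 1) ∈ Set.Ioo (-1 : ℝ) 1 := hj'
  rw [scaledWeight, Set.indicator_of_mem hj, reflWeight_eq]
  have hp : (0 : ℝ) < (j : ℝ) + 1 := by positivity
  have hk := one_sub_sq_pos (abs_lt.2 hj)
  rw [div_mul_eq_mul_div, mul_left_comm, mul_div_cancel_left₀ _ hp.ne', Real.exp_nat_mul,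
    Real.exp_log hk]

theorem tendsto_integral_scaledWeight_mul {g : ℕ → ℝ → ℝ} {G : ℝ → ℝ} {C : ℝ}
    (hg : ∀ j, Measurable (g j)) (hC : ∀ j x, |g j x| ≤ C)
    (hlim : ∀ x, Tendsto (fun j => g j x) atTop (𝓝 (G x))) :
    Tendsto (fun j => ∫ x, scaledWeight j x * g j x) atTop
      (𝓝 (∫ x, Real.exp (-(1 / 2) * x ^ 2) * G x)) := by
  refine tendsto_integral_of_dominated_convergence
    (fun x => 2 * Real.exp 1 * Real.exp (-(1 / 2) * x ^ 2) * C)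
    (fun j => ((measurable_scaledWeight j).mul (hg j)).aestronglyMeasurable)
    (((integrable_exp_neg_mul_sq (by norm_num)).const_mul _).mul_const _)
    (fun j => ae_of_all _ fun x => ?_)
    (ae_of_all _ fun x => (tendsto_scaledWeight x).mul (hlim x))
  rw [norm_mul, Real.norm_eq_abs, Real.norm_eq_abs, abs_of_nonneg (scaledWeight_nonneg j x)]
  exact mul_le_mul (scaledWeight_le j x) (hC j x) (abs_nonneg _) (by positivity)

theorem integral_gaussianReal_zero_one (g : ℝ → ℝ) :
    ∫ x, g x ∂(gaussianReal 0 1) =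
      (∫ x, Real.exp (-(1 / 2) * x ^ 2) * g x) / ∫ x : ℝ, Real.exp (-(1 / 2) * x ^ 2) := by
  rw [integral_gaussianReal_eq_integral_smul one_ne_zero, integral_gaussian,
    ← integral_div]
  refine integral_congr_ae (ae_of_all _ fun x => ?_)
  simp only [gaussianPDFReal, smul_eq_mul, NNReal.coe_one, mul_one, sub_zero]
  rw [show Real.pi / (1 / 2) = 2 * Real.pi by ring, show -x ^ 2 / 2 = -(1 / 2) * x ^ 2 by ring]
  ring

theorem integral_chiSquared_one {g : ℝ → ℝ} (hg : Measurable g) :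
    ∫ y, g y ∂(chiSquared 1) = ∫ x, g (x ^ 2) ∂(gaussianReal 0 1) := by
  have h := measurePreserving_eval (fun _ : Fin 1 => gaussianReal 0 1) 0
  rw [chiSquared, integral_map (Measurable.aemeasurable (by fun_prop)) hg.aestronglyMeasurable]
  conv_rhs => rw [← h.map_eq]
  have hg2 : Measurable fun x : ℝ => g (x ^ 2) := hg.comp (by fun_prop)
  rw [integral_map h.measurable.aemeasurable hg2.aestronglyMeasurable]
  simp

/-- The scaled reflection coefficients are asymptotically standard normal, by dominated
convergence of their unnormalized densities. Hence transforms that behave like the square after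
scaling converge to the chi-square law. -/
theorem tendsto_integral_reflLaw {T : ℕ → ℝ → ℝ} (hT : ∀ j, Measurable (T j))
    (hlim : ∀ x : ℝ, Tendsto (fun j : ℕ => T j (x / √(j + 1))) atTop (𝓝 (x ^ 2)))
    (φ : BoundedContinuousFunction ℝ ℝ) :
    Tendsto (fun j => ∫ k, φ (T j k) ∂(reflLaw j)) atTop
      (𝓝 (∫ y, φ y ∂(chiSquared 1))) := by
  rw [integral_chiSquared_one φ.continuous.measurable, integral_gaussianReal_zero_one]
  simp only [integral_reflLaw_eq_scaled]
  have h1 := tendsto_integral_scaledWeight_mul (g := fun j x => φ (T j (x / √(j + 1))))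
    (G := fun x => φ (x ^ 2)) (C := ‖φ‖)
    (fun j => φ.continuous.measurable.comp ((hT j).comp (by fun_prop)))
    (fun j x => φ.norm_coe_le_norm _) fun x => (φ.continuous.tendsto _).comp (hlim x)
  have h2 := tendsto_integral_scaledWeight_mul (g := fun _ _ => 1) (G := fun _ => 1) (C := 1)
    (fun _ => measurable_const) (fun _ _ => by simp) fun _ => tendsto_const_nhds
  simp only [mul_one] at h2
  refine h1.div h2 ?_
  rw [integral_gaussian]
  positivity

theorem tendstoInDistribution_chiSquared {Ω : ℕ → Type*} [∀ L, MeasurableSpace (Ω L)]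
    {P : ∀ L, Measure (Ω L)} [∀ L, IsProbabilityMeasure (P L)] {Y : ∀ L, Ω L → ℝ}
    {T : ℕ → ℝ → ℝ} (hT : ∀ j, Measurable (T j))
    (hlim : ∀ x : ℝ, Tendsto (fun j : ℕ => T j (x / √(j + 1))) atTop (𝓝 (x ^ 2)))
    (h0 : AEMeasurable (Y 0) (P 0)) {K : ∀ j, Ω (j + 1) → ℝ}
    (hK : ∀ j, HasLaw (K j) (reflLaw j) (P (j + 1)))
    (hY : ∀ j, Y (j + 1) =ᵐ[P (j + 1)] fun ω => T j (K j ω)) :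
    TendstoInDistribution Y atTop id P (chiSquared 1) := by
  have hm : ∀ L, AEMeasurable (Y L) (P L) := by
    rintro (_ | j)
    · exact h0
    · exact ((hT j).comp_aemeasurable (hK j).aemeasurable).congr (hY j).symm
  refine ⟨hm, aemeasurable_id, ?_⟩
  refine (tendsto_add_atTop_iff_nat (f := fun L =>
    (⟨_, Measure.isProbabilityMeasure_map (hm L)⟩ : ProbabilityMeasure ℝ)) 1).1
    (ProbabilityMeasure.tendsto_iff_forall_integral_tendsto.2 fun φ => ?_)
  simp only [ProbabilityMeasure.coe_mk, Measure.map_id]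
  refine (tendsto_integral_reflLaw hT hlim φ).congr fun j => ?_
  have hφ : Measurable fun k => φ (T j k) := φ.continuous.measurable.comp (hT j)
  rw [integral_map (hm _) φ.continuous.aestronglyMeasurable, ← (hK j).map_eq,
    integral_map (hK j).aemeasurable hφ.aestronglyMeasurable]
  refine integral_congr_ae ?_
  filter_upwards [hY j] with ω h
  rw [h]

/-! ### Uniformly distributed filters -/

section Uniform

variable {Ω : Type*} [MeasurableSpace Ω] {P : Measure Ω} {L : ℕ}
  {Ψ : Ω → Fin L → ℝ}

theorem hasLaw_reflCoeff_apply [IsProbabilityMeasure P]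
    (h : pdf.IsUniform Ψ (stableSet L 1) P volume) (i : Fin L) :
    HasLaw (fun ω => reflCoeff (Ψ ω) i) (reflLaw i) P :=
  (measurePreserving_eval (fun i : Fin L => reflLaw i) i).fun_comp_hasLaw (hasLaw_reflCoeff h)

theorem filterPacf_ae_eq {v : ℝ≥0} (hv : 0 < v)
    (h : pdf.IsUniform Ψ (stableSet L 1) P volume) (i : Fin L) :
    (fun ω => filterPacf v (Ψ ω) ((i : ℕ) + 1)) =ᵐ[P] fun ω => reflCoeff (Ψ ω) i := by
  filter_upwards [ae_mem_strictStable h] with ω hω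
  exact (filterPacf_and_filterGain hv hω i).1

theorem filterGain_ae_eq {v : ℝ≥0} (hv : 0 < v)
    (h : pdf.IsUniform Ψ (stableSet L 1) P volume) (i : Fin L) :
    (fun ω => filterGain v (Ψ ω) ((i : ℕ) + 1)) =ᵐ[P]
      fun ω => -Real.log (1 - reflCoeff (Ψ ω) i ^ 2) := by
  filter_upwards [ae_mem_strictStable h] with ω hω
  exact (filterPacf_and_filterGain hv hω i).2

theorem iIndepFun_filterPacf [IsProbabilityMeasure P] {v : ℝ≥0} (hv : 0 < v)
    (h : pdf.IsUniform Ψ (stableSet L 1) P volume) :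
    iIndepFun (fun (i : Fin L) ω => filterPacf v (Ψ ω) ((i : ℕ) + 1)) P :=
  (iIndepFun_congr (filterPacf_ae_eq hv h)).2
    ((iIndepFun_iff_hasLaw_pi_pi (hasLaw_reflCoeff_apply h)).2 (hasLaw_reflCoeff h))

theorem hasLaw_filterPacf [IsProbabilityMeasure P] {v : ℝ≥0} (hv : 0 < v)
    (h : pdf.IsUniform Ψ (stableSet L 1) P volume) (i : Fin L) :
    HasLaw (fun ω => (filterPacf v (Ψ ω) ((i : ℕ) + 1) + 1) / 2)
      (betaMeasure ((((i : ℕ) + 1) / 2 + 1 : ℕ) : ℝ) (((i : ℕ) / 2 + 1 : ℕ) : ℝ)) P := by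
  have h1 : HasLaw (fun k : ℝ => (k + 1) / 2)
      (betaMeasure ((((i : ℕ) + 1) / 2 + 1 : ℕ) : ℝ) (((i : ℕ) / 2 + 1 : ℕ) : ℝ))
      (reflLaw i) := ⟨by fun_prop, map_reflLaw i⟩
  refine (h1.fun_comp (hasLaw_reflCoeff_apply h i)).congr ?_
  filter_upwards [filterPacf_ae_eq hv h i] with ω hω
  rw [hω]

end Uniform

end ARFilter

theorem theorem1 (v : ℝ≥0) (hv : 0 < v) :
    -- independence and exact laws, for a filter uniform on `S_{L₀}(1)`
    (∀ (L₀ : ℕ) (_ : 1 ≤ L₀) (Ω : Type*) [MeasurableSpace Ω] (P : Measure Ω)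
        [IsProbabilityMeasure P] (Ψ : Ω → Fin L₀ → ℝ)
        (_ : pdf.IsUniform Ψ (ARFilter.stableSet L₀ 1) P volume),
      iIndepFun (fun (i : Fin L₀) ω => ARFilter.filterPacf v (Ψ ω) ((i : ℕ) + 1)) P ∧
      ∀ L : ℕ, 1 ≤ L → L ≤ L₀ →
        HasLaw (fun ω => (ARFilter.filterPacf v (Ψ ω) L + 1) / 2)
          (betaMeasure (⌊(L : ℝ) / 2 + 1⌋₊ : ℝ) (⌊((L : ℝ) + 1) / 2⌋₊ : ℝ)) P) ∧
    -- asymptotics as `L → ∞`, the order `L₀ = n L` of the random filter being any number `≥ L`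
    (∀ (n : ℕ → ℕ) (_ : ∀ L, L ≤ n L) (Ω : ℕ → Type*) [∀ L, MeasurableSpace (Ω L)]
        (P : ∀ L, Measure (Ω L)) [∀ L, IsProbabilityMeasure (P L)]
        (Ψ : ∀ L, Ω L → Fin (n L) → ℝ)
        (_ : ∀ L, pdf.IsUniform (Ψ L) (ARFilter.stableSet (n L) 1) (P L) volume),
      TendstoInDistribution
        (fun (L : ℕ) ω => (L : ℝ) * ARFilter.filterPacf v (Ψ L ω) L ^ 2) atTop
        id P (ARFilter.chiSquared 1) ∧
      TendstoInDistribution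
        (fun (L : ℕ) ω => (L : ℝ) * ARFilter.filterGain v (Ψ L ω) L) atTop
        id P (ARFilter.chiSquared 1)) := by
  refine ⟨fun L₀ _ Ω _ P _ Ψ hΨ => ⟨ARFilter.iIndepFun_filterPacf hv hΨ, fun L hL1 hL => ?_⟩,
    fun n hn Ω _ P _ Ψ hΨ => ?_⟩
  · obtain ⟨j, rfl⟩ : ∃ j, L = j + 1 := ⟨L - 1, by omega⟩
    have h := ARFilter.hasLaw_filterPacf hv hΨ ⟨j, hL⟩
    have h1 : ⌊((j + 1 : ℕ) : ℝ) / 2 + 1⌋₊ = (j + 1) / 2 + 1 := by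
      rw [Nat.floor_add_one (by positivity)]
      exact congrArg (· + 1) (Nat.floor_div_ofNat _ 2 |>.trans (by rw [Nat.floor_natCast]))
    have h2 : ⌊(((j + 1 : ℕ) : ℝ) + 1) / 2⌋₊ = j / 2 + 1 := by
      rw [← Nat.cast_succ, Nat.floor_div_ofNat, Nat.floor_natCast]
      show (j + 1 + 1) / 2 = _
      omega
    rw [h1, h2]
    exact h
  · -- `K j` is the reflection coefficient of index `j`, that is of order `j + 1`.
    let K : ∀ j, Ω (j + 1) → ℝ := fun j ω =>
      ARFilter.reflCoeff (Ψ (j + 1) ω) ⟨j, hn (j + 1)⟩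
    have hK : ∀ j, HasLaw (K j) (ARFilter.reflLaw j) (P (j + 1)) := fun j =>
      ARFilter.hasLaw_reflCoeff_apply (hΨ (j + 1)) ⟨j, hn (j + 1)⟩
    constructor
    · refine ARFilter.tendstoInDistribution_chiSquared (T := fun j k => ((j : ℝ) + 1) * k ^ 2)
        (fun j => by fun_prop) (fun x => ?_) (by simp) hK fun j => ?_
      · refine tendsto_const_nhds.congr fun j => ?_
        rw [div_pow, Real.sq_sqrt (by positivity)]
        field_simp
      · filter_upwards [ARFilter.filterPacf_ae_eq hv (hΨ (j + 1)) ⟨j, hn (j + 1)⟩] with ω h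
        rw [Nat.cast_succ, h]
    · refine ARFilter.tendstoInDistribution_chiSquared
        (T := fun j k => ((j : ℝ) + 1) * -Real.log (1 - k ^ 2))
        (fun j => by fun_prop) (fun x => ?_) (by simp) hK fun j => ?_
      · simpa using (ARFilter.tendsto_mul_log_one_sub x).neg
      · filter_upwards [ARFilter.filterGain_ae_eq hv (hΨ (j + 1)) ⟨j, hn (j + 1)⟩] with ω h
        rw [Nat.cast_succ, h]
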